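/- **Setting.** Let $d\ge 1$, let $\mathcal D$ be a probability distribution of samples $\xi$, let $f_\xi:\mathbb R^d\to\mathbb R$ be random losses with expected loss $f(x)=\mathbb E_{\xi\sim\mathcal D}[f_\xi(x)]$, and let $\|\cdot\|$ be the Euclidean norm. Let $L,\sigma>0$, $\alpha\in(1,2]$, $x^0,x^\star\in\mathbb R^d$, $R\ge\|x^0-x^\star\|$ and $Q=\{x:\|x-x^\star\|\le 2R\}$. Assume that $x^\star$ minimizes $f$ over $Q$ (for instance, over $\mathbb R^d$), that $f$ is differentiable at the points of $Q$, and that for all $x,y\in Q$ $$\|\nabla f(x)-\nabla f(y)\|\le L\|x-y\|,\qquad f(y)\ge f(x)+\langle\nabla f(x),y-x\rangle,$$ $$\mathbb E_\xi[\nabla f_\xi(x)]=\nabla f(x),\qquad \mathbb E_\xi\|\nabla f_\xi(x)-\nabla f(x)\|^\alpha\le\sigma^\alpha .$$ DP-Clipped-SGD with step-size $\gamma$, clipping level $\lambda>0$ and noise scale $\sigma_\omega$ is the recursion $$x^{k+1}=x^k-\gamma\big(\mathrm{clip}(\nabla f_{\xi^k}(x^k),\lambda)+\omega_k\big),\qquad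 \mathrm{clip}(v,\lambda)=\min\{1,\lambda/\|v\|\}\,v,$$ with $\xi^k\sim\mathcal D$, $\omega_k\sim\mathcal N(0,\sigma_\omega^2 I_d)$, all independent. Put $$\zeta_\lambda=\max\{0,2LR-\tfrac\lambda2\},\qquad S=\sigma^\alpha+\zeta_\lambda^\alpha,\qquad B=\frac{LR}{\lambda}+\frac{\lambda^{\alpha-1}\zeta_\lambda}{S}+\sigma S^{-1/\alpha}.$$ **Statement.** For every $A>0$ there is $c_0>0$ such that for all $c\in(0,c_0]$ and all $0<a_1\le a_2$ there is $C>0$ with the following property, for every problem and algorithm as above (the constants depend on nothing else). Let $K\ge1$ be an integer, $\beta\in(0,1]$, $\varepsilon>0$, $\delta\in(0,1)$; let the clipping level satisfy $$\lambda^\alpha\ln\tfrac K\beta\le A^\alpha K S$$ (which holds in particular if $\lambda\le A\sigma\,(K/\ln\frac K\beta)^{1/\alpha}$); let $\sigma_\omega=\Theta\big(\frac\lambda\varepsilon\sqrt{K\ln\frac K\delta\ln\frac1\delta}\big)$ in the sense that $$a_1\,\frac{\lambda}{\varepsilon}\sqrt{K\ln\tfrac K\delta\ln\tfrac1\delta}\;\le\;\sigma_\omega\;\le\;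 a_2\,\frac{\lambda}{\varepsilon}\sqrt{K\ln\tfrac K\delta\ln\tfrac1\delta},$$ and let $$\gamma=c\,\min\left\{\frac1L,\ \frac{R}{\lambda^{1-\alpha/2}\sqrt{K\ln(\frac K\beta)\,S}},\ \frac{R\lambda^{\alpha-1}}{K S B},\ \frac{R}{\sigma_\omega\sqrt{dK\ln\frac K\beta}}\right\}.$$ Then, with probability at least $1-\beta$, $$\min_{0\le t\le K}f(x^t)-f(x^\star)\le C\max\{T_1,T_2,T_3,T_4\},$$ where $$T_1=\frac{LR^2}{K}+\frac{L^3R^4}{\lambda^2K^2},\qquad T_2=R\lambda^{1-\alpha/2}\sqrt{\frac{S\ln(K/\beta)}{K}}+\frac{LR^2 S\ln(K/\beta)}{\lambda^{\alpha}K},$$ $$T_3=\frac{R S B}{\lambda^{\alpha-1}}+\frac{R^2L\,S^2B^2}{\lambda^{2\alpha}},\qquad T_4=\frac{R\lambda}{\varepsilon}\sqrt{d\ln\tfrac K\beta\ln\tfrac K\delta\ln\tfrac1\delta}+\frac{LR^2d\,\ln\frac K\beta\ln\frac K\delta\ln\frac1\delta}{\varepsilon^2}.$$ (For $K=\beta=1$,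 where $\ln(K/\beta)=0$, the claim is void, since $1-\beta=0$.) -/

import Mathlib

open MeasureTheory ProbabilityTheory
open scoped Gradient

namespace DPClippedSGD

noncomputable section

/-- The space `ℝ^d` with its Euclidean norm. -/
abbrev Vec (d : ℕ) : Type := EuclideanSpace ℝ (Fin d)

/-- The clipping operator `clip(v, lam) = min {1, lam / ‖v‖} v` (and `clip(0, lam) = 0`). -/
def clip {d : ℕ} (v : Vec d) (lam : ℝ) : Vec d := min 1 (lam / ‖v‖) • v

/-- The expected loss `f(x) = 𝔼_{ξ ∼ D} [ℓ_ξ(x)]`. -/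
def objective {d : ℕ} {Ξ : Type*} [MeasurableSpace Ξ] (D : Measure Ξ) (ℓ : Ξ → Vec d → ℝ)
    (x : Vec d) : ℝ :=
  ∫ ξ, ℓ ξ x ∂D

/-- The DP noise distribution: the centred Gaussian on `ℝ^d` with covariance `s² I_d`. -/
def gaussianNoise (d : ℕ) (s : ℝ) : Measure (Vec d) :=
  multivariateGaussian 0 ((s ^ 2) • (1 : Matrix (Fin d) (Fin d) ℝ))

/-- The iterates of DP-Clipped-SGD along one sequence of samples `ξ` and noise vectors `w`:
`x^{k+1} = x^k - γ (clip(∇ℓ_{ξ^k}(x^k), lam) + w_k)`. -/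
def iterate {d : ℕ} {Ξ : Type*} (ℓ : Ξ → Vec d → ℝ) (γ lam : ℝ) (x₀ : Vec d)
    (ξ : ℕ → Ξ) (w : ℕ → Vec d) : ℕ → Vec d
  | 0 => x₀
  | k + 1 =>
      iterate ℓ γ lam x₀ ξ w k - γ • (clip (∇ (ℓ (ξ k)) (iterate ℓ γ lam x₀ ξ w k)) lam + w k)

/-- `min_{t ∈ {0, …, K}} f(x^t)`. -/
def bestValue {d : ℕ} (f : Vec d → ℝ) (x : ℕ → Vec d) (K : ℕ) : ℝ :=
  (Finset.range (K + 1)).inf' Finset.nonempty_range_add_one (fun t => f (x t))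

/-- `f` is differentiable at the points of `Q` and its gradient is `L`-Lipschitz on `Q`. -/
def SmoothOn {d : ℕ} (f : Vec d → ℝ) (L : ℝ) (Q : Set (Vec d)) : Prop :=
  (∀ x ∈ Q, DifferentiableAt ℝ f x) ∧ ∀ x ∈ Q, ∀ y ∈ Q, ‖∇ f x - ∇ f y‖ ≤ L * ‖x - y‖

/-- First-order convexity of `f` on `Q`. -/
def FirstOrderConvexOn {d : ℕ} (f : Vec d → ℝ) (Q : Set (Vec d)) : Prop :=
  ∀ x ∈ Q, ∀ y ∈ Q, f x + inner ℝ (∇ f x) (y - x) ≤ f y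

/-- On `Q` the stochastic gradient is unbiased and its central moment of order `α` is at most
`σ ^ α`. -/
def HeavyTailedOracle {d : ℕ} {Ξ : Type*} [MeasurableSpace Ξ] (D : Measure Ξ)
    (ℓ : Ξ → Vec d → ℝ) (σ α : ℝ) (Q : Set (Vec d)) : Prop :=
  ∀ x ∈ Q,
    (Integrable (fun ξ => ∇ (ℓ ξ) x) D ∧ ∫ ξ, ∇ (ℓ ξ) x ∂D = ∇ (objective D ℓ) x) ∧
    (Integrable (fun ξ => ‖∇ (ℓ ξ) x - ∇ (objective D ℓ) x‖ ^ α) D ∧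
      ∫ ξ, ‖∇ (ℓ ξ) x - ∇ (objective D ℓ) x‖ ^ α ∂D ≤ σ ^ α)

/-- `ζ_lam = max {0, 2 L R - lam / 2}`. -/
def zeta (L R lam : ℝ) : ℝ := max 0 (2 * L * R - lam / 2)

/-- `S = σ^α + ζ_lam^α`. -/
def effNoise (L R σ α lam : ℝ) : ℝ := σ ^ α + zeta L R lam ^ α

/-- `B = L R / lam + lam^(α-1) ζ_lam / S + σ S^(-1/α)`. -/
def biasFactor (L R σ α lam : ℝ) : ℝ :=
  L * R / lam + lam ^ (α - 1) * zeta L R lam / effNoise L R σ α lam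
    + σ * effNoise L R σ α lam ^ (-1 / α)

/-- The minimum in the step-size condition. -/
def stepSizeMin (d K : ℕ) (L R σ α lam β σω : ℝ) : ℝ :=
  min (min (1 / L)
      (R / (lam ^ (1 - α / 2) * √(K * Real.log (K / β) * effNoise L R σ α lam))))
    (min (R * lam ^ (α - 1) / (K * effNoise L R σ α lam * biasFactor L R σ α lam))
      (R / (σω * √(d * K * Real.log (K / β)))))

/-- The DP noise scale `(lam / ε) √(K ln(K/δ) ln(1/δ))`. -/
def dpScale (K : ℕ) (lam ε δ : ℝ) : ℝ :=
  lam / ε * √(K * Real.log (K / δ) * Real.log (1 / δ))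

/-- The deterministic decreasing term. -/
def detTerm (K : ℕ) (L R lam : ℝ) : ℝ :=
  L * R ^ 2 / K + L ^ 3 * R ^ 4 / (lam ^ 2 * K ^ 2)

/-- The stochastic decreasing term. -/
def stochTerm (K : ℕ) (L R σ α lam β : ℝ) : ℝ :=
  R * lam ^ (1 - α / 2) * √(effNoise L R σ α lam * Real.log (K / β) / K)
    + L * R ^ 2 * effNoise L R σ α lam * Real.log (K / β) / (lam ^ α * K)

/-- The clipping-bias neighbourhood. -/
def biasTerm (L R σ α lam : ℝ) : ℝ :=
  R * effNoise L R σ α lam * biasFactor L R σ α lam / lam ^ (α - 1)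
    + R ^ 2 * L * effNoise L R σ α lam ^ 2 * biasFactor L R σ α lam ^ 2 / lam ^ (2 * α)

/-- The DP-noise neighbourhood. -/
def dpTerm (d K : ℕ) (L R lam β ε δ : ℝ) : ℝ :=
  R * lam / ε * √(d * Real.log (K / β) * Real.log (K / δ) * Real.log (1 / δ))
    + L * R ^ 2 * d * Real.log (K / β) * Real.log (K / δ) * Real.log (1 / δ) / ε ^ 2

end

end DPClippedSGD

/-! Write the clipped stochastic gradient at `x` as `G + θ`, with `G` its mean and `θ` centred.
Splitting a heavy-tailed sample at level `lam` shows that the bias `G - ∇f(x)` is of order `S B /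
lam ^ (α - 1)`, that `‖θ‖ ≤ 2 lam`, and that `θ` has variance at most `4 lam ^ (2 - α) S`. So after
clipping the noise has exponential moments, as has the Gaussian noise.

Expanding `‖x^{k+1} - x*‖²` with convexity and smoothness on `Q` gives a decrease of `γ (f(x^k) -
f(x*))`, up to a bias contribution and a noise contribution (`norm_step_sq_le`). The step-size keeps
the total bias below `R² / 2`. If the accumulated noise also stays below `R² / 2`, induction keeps
every iterate within `√2 R` of `x*`, inside `Q`, and the gaps sum to at most `2 R² / γ`
(`sum_gap_le`).

With `l = ln(K / β)`, the noise of one step times `4 l / R²` has conditional exponential moment at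
most `exp (l / K)` as long as the iterate lies in that ball (`lintegral_exp_noiseTerm_le`). Setting
the noise to zero outside the ball makes this unconditional. A supermartingale product and Markov's
inequality at level `2 l` then bound the failure probability at each time by `exp (-l) = β / K`, and
a union over `K` times gives `β` (`measure_exists_sum_ge_le`).

On the good event the best gap is at most `2 R² / (γ K)`. Whichever entry of the minimum defines
`γ`, this is a multiple of the first summand of the corresponding `T_i` (`rate_le`). -/

namespace DPClippedSGD

/-! ### Clipping: bias, variance and exponential moments -/

section Clipping

variable {d : ℕ} {lam : ℝ}

lemma clip_of_norm_le {v : Vec d} (hv : ‖v‖ ≤ lam) : clip v lam = v := by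
  rcases eq_or_ne v 0 with rfl | h0
  · simp [clip]
  · have : 0 < ‖v‖ := norm_pos_iff.2 h0
    rw [clip, min_eq_left ((one_le_div this).2 hv), one_smul]

lemma clip_of_le_norm {v : Vec d} (hlam : 0 < lam) (hv : lam ≤ ‖v‖) :
    clip v lam = (lam / ‖v‖) • v := by
  rw [clip, min_eq_right ((div_le_one (hlam.trans_le hv)).2 hv)]

lemma norm_clip_le (hlam : 0 < lam) (v : Vec d) : ‖clip v lam‖ ≤ lam := by
  rcases le_total ‖v‖ lam with h | h
  · rwa [clip_of_norm_le h]
  · have : 0 < ‖v‖ := hlam.trans_le h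
    rw [clip_of_le_norm hlam h, norm_smul, Real.norm_of_nonneg (by positivity),
      div_mul_cancel₀ _ this.ne']

lemma norm_sub_clip (hlam : 0 < lam) (v : Vec d) : ‖clip v lam - v‖ = max 0 (‖v‖ - lam) := by
  rcases le_total ‖v‖ lam with h | h
  · rw [clip_of_norm_le h, max_eq_left (by linarith)]; simp
  · have h0 : 0 < ‖v‖ := hlam.trans_le h
    have h1 : (lam / ‖v‖) • v - v = (lam / ‖v‖ - 1) • v := by rw [sub_smul, one_smul]
    have h2 : lam / ‖v‖ - 1 ≤ 0 := by rw [sub_nonpos, div_le_one h0]; exact h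
    rw [clip_of_le_norm hlam h, max_eq_right (by linarith), h1, norm_smul,
      Real.norm_of_nonpos h2]
    field_simp
    ring

/-- Clipping is the projection onto a ball, hence even 1-Lipschitz. The constant 2 suffices here and
needs only the triangle inequality through `(lam / ‖x‖) • y`, where `x` is the longer vector. -/
lemma norm_clip_sub_clip_le (hlam : 0 < lam) (x y : Vec d) :
    ‖clip x lam - clip y lam‖ ≤ 2 * ‖x - y‖ := by
  wlog hxy : ‖y‖ ≤ ‖x‖ generalizing x y
  · rw [norm_sub_rev, norm_sub_rev x]
    exact this y x (le_of_not_ge hxy)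
  have hn : ‖x‖ - ‖y‖ ≤ ‖x - y‖ := norm_sub_norm_le x y
  rcases le_total ‖x‖ lam with hx | hx
  · rw [clip_of_norm_le hx, clip_of_norm_le (hxy.trans hx)]
    linarith [norm_nonneg (x - y)]
  have hx0 : 0 < ‖x‖ := hlam.trans_le hx
  have key : clip x lam - clip y lam
      = (lam / ‖x‖) • (x - y) + ((lam / ‖x‖) • y - clip y lam) := by
    rw [clip_of_le_norm hlam hx, smul_sub]; abel
  have h1 : ‖(lam / ‖x‖) • (x - y)‖ ≤ ‖x - y‖ := by
    rw [norm_smul, Real.norm_of_nonneg (by positivity)]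
    exact mul_le_of_le_one_left (norm_nonneg _) ((div_le_one hx0).2 hx)
  have h2 : ‖(lam / ‖x‖) • y - clip y lam‖ ≤ ‖x‖ - ‖y‖ := by
    rcases le_total ‖y‖ lam with hy | hy
    · have e : (lam / ‖x‖) • y - y = (lam / ‖x‖ - 1) • y := by rw [sub_smul, one_smul]
      have h3 : lam / ‖x‖ - 1 ≤ 0 := by rw [sub_nonpos, div_le_one hx0]; exact hx
      rw [clip_of_norm_le hy, e, norm_smul, Real.norm_of_nonpos h3]
      have : -(lam / ‖x‖ - 1) * ‖x‖ = ‖x‖ - lam := by field_simp; ring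
      nlinarith [norm_nonneg y]
    · have hy0 : 0 < ‖y‖ := hlam.trans_le hy
      have h3 : lam / ‖x‖ ≤ lam / ‖y‖ := by gcongr
      rw [clip_of_le_norm hlam hy, ← sub_smul, norm_smul, Real.norm_of_nonpos (by linarith)]
      have e1 : -(lam / ‖x‖ - lam / ‖y‖) * ‖y‖ = lam / ‖x‖ * (‖x‖ - ‖y‖) := by
        field_simp; ring
      rw [e1]
      exact mul_le_of_le_one_left (by linarith) ((div_le_one hx0).2 hx)
  rw [key]
  exact (norm_add_le _ _).trans (by linarith)

lemma measurable_clip : Measurable fun v : Vec d => clip v lam := by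
  unfold clip
  fun_prop

/-- Markov-type bound for the part of `y` above `a`, in terms of `y ^ α`. -/
lemma sub_le_rpow_mul {y a α : ℝ} (hy : 0 ≤ y) (ha : 0 < a) (hα : 1 < α) :
    max 0 (y - a) ≤ a ^ (1 - α) * y ^ α := by
  apply max_le (by positivity)
  rcases le_or_gt y a with h | h
  · exact (sub_nonpos.2 h).trans (by positivity)
  · have h0 : 0 < y := ha.trans h
    have h1 : y ^ (1 - α) ≤ a ^ (1 - α) :=
      Real.rpow_le_rpow_of_nonpos ha h.le (by linarith)
    have h2 : y ^ (1 - α) * y ^ α = y := by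
      rw [← Real.rpow_add h0]; simp
    have := mul_le_mul_of_nonneg_right h1 (by positivity : 0 ≤ y ^ α)
    linarith

variable {Ξ : Type*} [MeasurableSpace Ξ] {D : Measure Ξ} [IsProbabilityMeasure D]

lemma integrable_clip {X : Ξ → Vec d} (hX : AEStronglyMeasurable X D) (hlam : 0 < lam) :
    Integrable (fun ξ => clip (X ξ) lam) D :=
  Integrable.of_bound ((measurable_clip.comp_aemeasurable hX.aemeasurable).aestronglyMeasurable)
    lam (.of_forall fun _ => norm_clip_le hlam _)

/-- The bias of the clipped estimator. -/
lemma norm_integral_clip_sub_le {X : Ξ → Vec d} {m : Vec d} {α s z : ℝ} (hX : Integrable X D)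
    (hm : ∫ ξ, X ξ ∂D = m) (hlam : 0 < lam) (hα : 1 < α) (hα2 : α ≤ 2) (hz : 0 ≤ z)
    (hmz : ‖m‖ ≤ lam / 2 + z) (hY : Integrable (fun ξ => ‖X ξ - m‖ ^ α) D)
    (hs : ∫ ξ, ‖X ξ - m‖ ^ α ∂D ≤ s) :
    ‖∫ ξ, clip (X ξ) lam ∂D - m‖ ≤ z + 2 * lam ^ (1 - α) * s := by
  have hc := integrable_clip hX.1 hlam
  -- Since `‖m‖ ≤ lam / 2 + z`, the excess of `‖X‖` over `lam` is at most `z` plus the excess of `‖X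
  -- - m‖` over `lam / 2`.
  have hpt : ∀ ξ, ‖clip (X ξ) lam - X ξ‖ ≤ z + (lam / 2) ^ (1 - α) * ‖X ξ - m‖ ^ α := by
    intro ξ
    rw [norm_sub_clip hlam]
    have h1 := sub_le_rpow_mul (norm_nonneg (X ξ - m)) (half_pos hlam) hα
    have h2 : ‖X ξ‖ ≤ ‖X ξ - m‖ + ‖m‖ := norm_le_norm_sub_add _ _
    have h3 := le_max_right 0 (‖X ξ - m‖ - lam / 2)
    have h4 := le_max_left 0 (‖X ξ - m‖ - lam / 2)
    exact max_le (by linarith) (by linarith)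
  have hpow : (lam / 2) ^ (1 - α) ≤ 2 * lam ^ (1 - α) := by
    rw [Real.div_rpow hlam.le zero_le_two, div_eq_mul_inv, ← Real.rpow_neg zero_le_two, mul_comm]
    gcongr
    calc (2 : ℝ) ^ (-(1 - α)) ≤ 2 ^ (1 : ℝ) :=
          Real.rpow_le_rpow_of_exponent_le one_le_two (by linarith)
      _ = 2 := by simp
  have hs0 : 0 ≤ s := (integral_nonneg fun ξ => by positivity).trans hs
  calc ‖∫ ξ, clip (X ξ) lam ∂D - m‖ = ‖∫ ξ, (clip (X ξ) lam - X ξ) ∂D‖ := by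
        rw [integral_sub hc hX, hm]
    _ ≤ ∫ ξ, (z + (lam / 2) ^ (1 - α) * ‖X ξ - m‖ ^ α) ∂D :=
        norm_integral_le_of_norm_le ((integrable_const z).add (hY.const_mul _)) (.of_forall hpt)
    _ = z + (lam / 2) ^ (1 - α) * ∫ ξ, ‖X ξ - m‖ ^ α ∂D := by
        rw [integral_add (integrable_const z) (hY.const_mul _), integral_const_mul]; simp
    _ ≤ z + (2 * lam ^ (1 - α)) * s := by gcongr

/-- The cross term in the expansion around the mean integrates to zero. This allows the variance of
the clipped gradient to be estimated around `clip m lam`, where the Lipschitz bound for clipping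
applies. -/
lemma integral_norm_sub_integral_sq_le {W : Ξ → Vec d} {M : ℝ} (hW : AEStronglyMeasurable W D)
    (hM : ∀ ξ, ‖W ξ‖ ≤ M) (a : Vec d) :
    ∫ ξ, ‖W ξ - ∫ η, W η ∂D‖ ^ 2 ∂D ≤ ∫ ξ, ‖W ξ - a‖ ^ 2 ∂D := by
  set m := ∫ η, W η ∂D with hm
  have hi : Integrable W D := .of_bound hW M (.of_forall hM)
  have hsq : ∀ b : Vec d, Integrable (fun ξ => ‖W ξ - b‖ ^ 2) D := by
    intro b
    refine .of_bound ((hW.sub aestronglyMeasurable_const).norm.pow 2) ((M + ‖b‖) ^ 2)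
      (.of_forall fun ξ => ?_)
    rw [Real.norm_of_nonneg (by positivity)]
    gcongr
    exact (norm_sub_le _ _).trans (by linarith [hM ξ])
  have hin : Integrable (fun ξ => inner ℝ (m - a) (W ξ - m)) D :=
    (hi.sub (integrable_const m)).const_inner (m - a)
  have h0 : ∫ ξ, inner ℝ (m - a) (W ξ - m) ∂D = 0 := by
    rw [integral_inner (f := fun ξ => W ξ - m) (hi.sub (integrable_const m)), integral_sub hi (integrable_const m)]
    simp [hm]
  have hle : ∀ ξ, ‖W ξ - m‖ ^ 2 + 2 * inner ℝ (m - a) (W ξ - m) ≤ ‖W ξ - a‖ ^ 2 := by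
    intro ξ
    have e : W ξ - a = (W ξ - m) + (m - a) := by abel
    rw [e, norm_add_sq_real, real_inner_comm]
    linarith [sq_nonneg ‖m - a‖]
  have := integral_mono ((hsq m).add (hin.const_mul 2)) (hsq a) hle
  rw [integral_add' (hsq m) (hin.const_mul 2), integral_const_mul, h0] at this
  simpa using this

/-- The variance of the clipped estimator. -/
lemma integral_norm_clip_sub_sq_le {X : Ξ → Vec d} {m : Vec d} {α s : ℝ}
    (hX : Integrable X D) (hlam : 0 < lam) (hα : 1 < α) (hα2 : α ≤ 2)
    (hY : Integrable (fun ξ => ‖X ξ - m‖ ^ α) D) (hs : ∫ ξ, ‖X ξ - m‖ ^ α ∂D ≤ s) :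
    ∫ ξ, ‖clip (X ξ) lam - ∫ η, clip (X η) lam ∂D‖ ^ 2 ∂D ≤ 4 * lam ^ (2 - α) * s := by
  have hc := integrable_clip hX.1 hlam
  -- Interpolation: of the two powers of `t`, `2 - α` are bounded by boundedness of clipping and `α`
  -- by its Lipschitz property.
  have hpt : ∀ ξ, ‖clip (X ξ) lam - clip m lam‖ ^ 2 ≤ 4 * lam ^ (2 - α) * ‖X ξ - m‖ ^ α := by
    intro ξ
    set t := ‖clip (X ξ) lam - clip m lam‖
    have ht0 : 0 ≤ t := norm_nonneg _
    have ht1 : t ≤ 2 * lam :=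
      (norm_sub_le _ _).trans (by linarith [norm_clip_le hlam (X ξ), norm_clip_le hlam m])
    have ht2 : t ≤ 2 * ‖X ξ - m‖ := norm_clip_sub_clip_le hlam _ _
    have e2 : (2 : ℝ) ^ (2 - α) * 2 ^ α = 4 := by
      rw [← Real.rpow_add two_pos]; norm_num
    calc t ^ 2 = t ^ (2 - α) * t ^ α := by
          rw [← Real.rpow_add_of_nonneg ht0 (by linarith) (by linarith)]; norm_num
      _ ≤ (2 * lam) ^ (2 - α) * (2 * ‖X ξ - m‖) ^ α := by gcongr
      _ = 4 * lam ^ (2 - α) * ‖X ξ - m‖ ^ α := by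
          rw [Real.mul_rpow zero_le_two hlam.le, Real.mul_rpow zero_le_two (norm_nonneg _), ← e2]
          ring
  calc _ ≤ ∫ ξ, ‖clip (X ξ) lam - clip m lam‖ ^ 2 ∂D :=
        integral_norm_sub_integral_sq_le hc.1 (fun ξ => norm_clip_le hlam _) _
    _ ≤ ∫ ξ, 4 * lam ^ (2 - α) * ‖X ξ - m‖ ^ α ∂D :=
        integral_mono_of_nonneg (.of_forall fun ξ => by positivity) (hY.const_mul _)
          (.of_forall hpt)
    _ = 4 * lam ^ (2 - α) * ∫ ξ, ‖X ξ - m‖ ^ α ∂D := integral_const_mul _ _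
    _ ≤ _ := by gcongr

/-- Exponential moment of a bounded centred noise vector, with a small quadratic term. -/
lemma lintegral_exp_inner_le {θ : Ξ → Vec d} {M V p q : ℝ} (hθ : AEStronglyMeasurable θ D)
    (hM : ∀ ξ, ‖θ ξ‖ ≤ M) (h0 : ∫ ξ, θ ξ ∂D = 0) (hV : ∫ ξ, ‖θ ξ‖ ^ 2 ∂D ≤ V)
    (u : Vec d) (hp : 0 ≤ p) (hq : 0 ≤ q) (hpq : p * ‖u‖ * M + q * M ^ 2 ≤ 1) :
    ∫⁻ ξ, ENNReal.ofReal (Real.exp (-p * inner ℝ u (θ ξ) + q * ‖θ ξ‖ ^ 2)) ∂D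
      ≤ ENNReal.ofReal (Real.exp ((q + 2 * (p ^ 2 * ‖u‖ ^ 2 + q ^ 2 * M ^ 2)) * V)) := by
  set b := q + 2 * (p ^ 2 * ‖u‖ ^ 2 + q ^ 2 * M ^ 2) with hb
  have hb0 : 0 ≤ b := by positivity
  have hi : Integrable θ D := .of_bound hθ M (.of_forall hM)
  have hin : Integrable (fun ξ => inner ℝ u (θ ξ)) D := hi.const_inner u
  have hsq : Integrable (fun ξ => ‖θ ξ‖ ^ 2) D := by
    refine .of_bound (hθ.norm.pow 2) (M ^ 2) (.of_forall fun ξ => ?_)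
    rw [Real.norm_of_nonneg (by positivity)]
    gcongr
    exact hM ξ
  -- `exp y ≤ 1 + y + y ^ 2` for `|y| ≤ 1`. The inner product is kept exactly because its mean
  -- vanishes; all else is at most `b * ‖θ‖ ^ 2`.
  have hpt : ∀ ξ, Real.exp (-p * inner ℝ u (θ ξ) + q * ‖θ ξ‖ ^ 2)
      ≤ 1 + -p * inner ℝ u (θ ξ) + b * ‖θ ξ‖ ^ 2 := by
    intro ξ
    set i := inner ℝ u (θ ξ) with hi
    set n := ‖θ ξ‖ with hn
    have hn0 : 0 ≤ n := norm_nonneg _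
    have hi1 : |i| ≤ ‖u‖ * n := abs_real_inner_le_norm _ _
    have hnM : n ≤ M := hM ξ
    have hpi : |-p * i| ≤ p * ‖u‖ * n := by
      rw [abs_mul, abs_neg, abs_of_nonneg hp, mul_assoc]
      gcongr
    have hy : |-p * i + q * n ^ 2| ≤ 1 := by
      refine (abs_add_le _ _).trans (le_trans ?_ hpq)
      rw [abs_of_nonneg (by positivity : 0 ≤ q * n ^ 2)]
      have : p * ‖u‖ * n ≤ p * ‖u‖ * M := by gcongr
      have : q * n ^ 2 ≤ q * M ^ 2 := by gcongr
      linarith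
    have h1 := (abs_le.1 (Real.abs_exp_sub_one_sub_id_le hy)).2
    have h2 : (-p * i) ^ 2 ≤ p ^ 2 * ‖u‖ ^ 2 * n ^ 2 := by
      rw [← sq_abs]
      calc |-p * i| ^ 2 ≤ (p * ‖u‖ * n) ^ 2 := by gcongr
        _ = _ := by ring
    have h3 : (q * n ^ 2) ^ 2 ≤ q ^ 2 * M ^ 2 * n ^ 2 := by
      calc (q * n ^ 2) ^ 2 = q ^ 2 * n ^ 2 * n ^ 2 := by ring
        _ ≤ _ := by gcongr
    have h4 : (-p * i + q * n ^ 2) ^ 2 ≤ 2 * ((-p * i) ^ 2 + (q * n ^ 2) ^ 2) := add_sq_le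
    rw [hb]
    linarith
  have hI : Integrable (fun ξ => 1 + -p * inner ℝ u (θ ξ) + b * ‖θ ξ‖ ^ 2) D :=
    ((integrable_const 1).add (hin.const_mul (-p))).add (hsq.const_mul b)
  calc _ ≤ ∫⁻ ξ, ENNReal.ofReal (1 + -p * inner ℝ u (θ ξ) + b * ‖θ ξ‖ ^ 2) ∂D :=
        lintegral_mono fun ξ => ENNReal.ofReal_le_ofReal (hpt ξ)
    _ = ENNReal.ofReal (∫ ξ, (1 + -p * inner ℝ u (θ ξ) + b * ‖θ ξ‖ ^ 2) ∂D) :=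
        (ofReal_integral_eq_lintegral_ofReal hI
          (.of_forall fun ξ => (Real.exp_pos _).le.trans (hpt ξ))).symm
    _ ≤ _ := by
        apply ENNReal.ofReal_le_ofReal
        rw [integral_add (f := fun ξ => 1 + -p * inner ℝ u (θ ξ))
            ((integrable_const 1).add (hin.const_mul (-p))) (hsq.const_mul b),
          integral_add (integrable_const 1) (hin.const_mul (-p)), integral_const_mul,
          integral_const_mul, integral_inner hi, h0]
        simp only [inner_zero_right, integral_const, probReal_univ, smul_eq_mul]
        have : b * ∫ ξ, ‖θ ξ‖ ^ 2 ∂D ≤ b * V := by gcongr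
        linarith [Real.add_one_le_exp (b * V)]

end Clipping

/-! ### Exponential moments of the Gaussian noise -/

section Gaussian

lemma integrable_exp_mul_sq_gaussianReal {t : ℝ} (ht : t < 1 / 2) :
    Integrable (fun x : ℝ => Real.exp (t * x ^ 2)) (gaussianReal 0 1) ∧
      ∫ x, Real.exp (t * x ^ 2) ∂(gaussianReal 0 1) = (√(1 - 2 * t))⁻¹ := by
  have hb : 0 < 1 / 2 - t := by linarith
  have e : ∀ x : ℝ, gaussianPDFReal 0 1 x * Real.exp (t * x ^ 2)
      = (√(2 * Real.pi))⁻¹ * Real.exp (-(1 / 2 - t) * x ^ 2) := by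
    intro x
    simp only [gaussianPDFReal, NNReal.coe_one, mul_one, sub_zero]
    rw [mul_assoc, ← Real.exp_add]
    congr 2
    ring
  constructor
  · rw [gaussianReal_of_var_ne_zero 0 one_ne_zero,
      integrable_withDensity_iff_integrable_smul' (measurable_gaussianPDF 0 1)
        (.of_forall fun x => gaussianPDF_lt_top)]
    simp only [toReal_gaussianPDF, smul_eq_mul, e]
    exact (integrable_exp_neg_mul_sq hb).const_mul _
  · rw [integral_gaussianReal_eq_integral_smul one_ne_zero]
    simp only [smul_eq_mul, e]
    rw [integral_const_mul, integral_gaussian, ← Real.sqrt_inv, ← Real.sqrt_inv,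
      ← Real.sqrt_mul (by positivity)]
    congr 1
    have := Real.pi_pos
    have h2 : 1 - 2 * t ≠ 0 := by linarith
    field_simp

/-- On `[0, 1/2]` one has `(1 - x) (1 + 2 x) = 1 + x (1 - 2 x) ≥ 1`, while `exp (2 x) ≥ 1 + 2 x`;
hence `exp (-2 x) ≤ 1 - x`. -/
lemma inv_sqrt_one_sub_le_exp {x : ℝ} (hx0 : 0 ≤ x) (hx : x ≤ 1 / 2) :
    (√(1 - x))⁻¹ ≤ Real.exp x := by
  have h1 : Real.exp (-x) ≤ √(1 - x) := by
    apply Real.le_sqrt_of_sq_le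
    have h2 : 1 + 2 * x ≤ Real.exp (2 * x) := by linarith [Real.add_one_le_exp (2 * x)]
    have h3 : Real.exp (-x) ^ 2 * Real.exp (2 * x) = 1 := by
      rw [← Real.exp_nat_mul, ← Real.exp_add]; simp
    nlinarith [mul_le_mul_of_nonneg_left h2 (sq_nonneg (Real.exp (-x))),
      mul_nonneg (sq_nonneg (Real.exp (-x))) (by nlinarith : 0 ≤ x * (1 - 2 * x))]
  rw [← neg_neg x, Real.exp_neg, neg_neg]
  exact inv_anti₀ (Real.exp_pos _) h1

/-- The inequality `2 p q ≤ p ^ 2 + q ^ 2` separates the linear from the quadratic exponent, and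
both resulting integrals are explicit. The bound `t ≤ 1 / 8` gives `4 t ≤ 1 / 2`, as the estimate of
`(√(1 - 4 t))⁻¹` requires. -/
lemma exp_add_gaussianReal {a t : ℝ} (ht0 : 0 ≤ t) (ht : t ≤ 1 / 8) :
    Integrable (fun x : ℝ => Real.exp (a * x + t * x ^ 2)) (gaussianReal 0 1) ∧
      ∫ x, Real.exp (a * x + t * x ^ 2) ∂(gaussianReal 0 1) ≤ Real.exp (2 * a ^ 2 + 4 * t) := by
  have hq := integrable_exp_mul_sq_gaussianReal (t := 2 * t) (by linarith)
  have hl : Integrable (fun x : ℝ => Real.exp (2 * a * x)) (gaussianReal 0 1) :=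
    integrable_exp_mul_gaussianReal (2 * a)
  have hl' : ∫ x, Real.exp (2 * a * x) ∂(gaussianReal 0 1) = Real.exp (2 * a ^ 2) := by
    have := congrFun (mgf_id_gaussianReal (μ := 0) (v := 1)) (2 * a)
    simp only [mgf, id] at this
    rw [this]
    congr 1
    simp
    ring
  have hpt : ∀ x : ℝ, Real.exp (a * x + t * x ^ 2)
      ≤ 1 / 2 * Real.exp (2 * a * x) + 1 / 2 * Real.exp (2 * t * x ^ 2) := by
    intro x
    have e1 : Real.exp (2 * a * x) = Real.exp (a * x) ^ 2 := by
      rw [← Real.exp_nat_mul]; congr 1; push_cast; ring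
    have e2 : Real.exp (2 * t * x ^ 2) = Real.exp (t * x ^ 2) ^ 2 := by
      rw [← Real.exp_nat_mul]; congr 1; push_cast; ring
    rw [e1, e2, Real.exp_add]
    linarith [two_mul_le_add_sq (Real.exp (a * x)) (Real.exp (t * x ^ 2))]
  have hdom : Integrable (fun x : ℝ => 1 / 2 * Real.exp (2 * a * x)
      + 1 / 2 * Real.exp (2 * t * x ^ 2)) (gaussianReal 0 1) :=
    (hl.const_mul _).add (hq.1.const_mul _)
  have hi : Integrable (fun x : ℝ => Real.exp (a * x + t * x ^ 2)) (gaussianReal 0 1) := by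
    refine hdom.mono' (by fun_prop) (.of_forall fun x => ?_)
    rw [Real.norm_of_nonneg (Real.exp_pos _).le]
    exact hpt x
  refine ⟨hi, (integral_mono hi hdom hpt).trans ?_⟩
  rw [integral_add (hl.const_mul _) (hq.1.const_mul _), integral_const_mul, integral_const_mul,
    hl', hq.2]
  have h1 := inv_sqrt_one_sub_le_exp (x := 2 * (2 * t)) (by linarith) (by linarith)
  have h2 : Real.exp (2 * a ^ 2) ≤ Real.exp (2 * a ^ 2 + 4 * t) :=
    Real.exp_le_exp.2 (by linarith)
  have h3 : Real.exp (2 * (2 * t)) ≤ Real.exp (2 * a ^ 2 + 4 * t) :=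
    Real.exp_le_exp.2 (by nlinarith [sq_nonneg a])
  linarith

/-- Both sides have the same characteristic function. The product form reduces exponential moments
in dimension `d` to one-dimensional ones. -/
lemma gaussianNoise_eq_map (d : ℕ) (s : ℝ) :
    gaussianNoise d s
      = (Measure.pi fun _ : Fin d => gaussianReal 0 1).map (fun x => s • WithLp.toLp 2 x) := by
  have hps : ((s ^ 2) • (1 : Matrix (Fin d) (Fin d) ℝ)).PosSemidef :=
    Matrix.PosSemidef.one.smul (sq_nonneg s)
  have h : (Measure.pi fun _ : Fin d => gaussianReal 0 1).map (fun x => s • WithLp.toLp 2 x)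
      = (stdGaussian (Vec d)).map (fun x => s • x) := by
    rw [← map_pi_eq_stdGaussian, Measure.map_map (by fun_prop) (by fun_prop)]
    rfl
  have : IsProbabilityMeasure ((stdGaussian (Vec d)).map (fun x => s • x)) :=
    Measure.isProbabilityMeasure_map (by fun_prop)
  rw [h, gaussianNoise]
  apply Measure.ext_of_charFun
  ext t
  rw [charFun_multivariateGaussian hps, charFun_map_smul, charFun_stdGaussian]
  congr 1
  simp only [inner_zero_right, Complex.ofReal_zero, zero_mul, zero_sub, norm_smul,
    Matrix.smul_mulVec, Matrix.one_mulVec, dotProduct_smul]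
  have : t.ofLp ⬝ᵥ t.ofLp = ‖t‖ ^ 2 := by
    rw [EuclideanSpace.real_norm_sq_eq]; simp [dotProduct, sq]
  rw [this]
  push_cast
  have hs : ((|s| : ℝ) : ℂ) ^ 2 = (s : ℂ) ^ 2 := by rw [← Complex.ofReal_pow, sq_abs]; simp
  simp only [smul_eq_mul, Complex.ofReal_mul, Complex.ofReal_pow, Real.norm_eq_abs, mul_pow, hs]
  ring

/-- Exponential moment of a linear plus a small quadratic function of the Gaussian noise. -/
lemma lintegral_exp_gaussianNoise_le {d : ℕ} {s p q : ℝ} (hq : 0 ≤ q) (hqs : q * s ^ 2 ≤ 1 / 8)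
    (u : Vec d) :
    ∫⁻ w, ENNReal.ofReal (Real.exp (-p * inner ℝ u w + q * ‖w‖ ^ 2)) ∂(gaussianNoise d s)
      ≤ ENNReal.ofReal (Real.exp (2 * p ^ 2 * s ^ 2 * ‖u‖ ^ 2 + 4 * d * (q * s ^ 2))) := by
  have hm : Measurable fun w : Vec d =>
      ENNReal.ofReal (Real.exp (-p * inner ℝ u w + q * ‖w‖ ^ 2)) := by fun_prop
  have e : ∀ x : Fin d → ℝ, Real.exp (-p * inner ℝ u (s • WithLp.toLp 2 x)
      + q * ‖s • WithLp.toLp 2 x‖ ^ 2)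
      = ∏ i, Real.exp ((-p * s * u i) * x i + (q * s ^ 2) * x i ^ 2) := by
    intro x
    rw [← Real.exp_sum]
    congr 1
    rw [inner_smul_right, norm_smul, mul_pow, EuclideanSpace.real_norm_sq_eq, Finset.sum_add_distrib,
      ← Finset.mul_sum, PiLp.inner_apply, Real.norm_eq_abs, sq_abs]
    simp only [mul_assoc, ← Finset.mul_sum]
    simp [mul_comm]
  have hone := fun i : Fin d => exp_add_gaussianReal (a := -p * s * u i) (t := q * s ^ 2)
    (by positivity) hqs
  rw [gaussianNoise_eq_map, lintegral_map hm (by fun_prop)]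
  simp only [e]
  rw [← ofReal_integral_eq_lintegral_ofReal
    (Integrable.fintype_prod (f := fun i y => Real.exp ((-p * s * u i) * y + (q * s ^ 2) * y ^ 2))
      fun i => (hone i).1) (.of_forall fun x => Finset.prod_nonneg fun i _ => (Real.exp_pos _).le),
    integral_fintype_prod_eq_prod
      (f := fun i y => Real.exp ((-p * s * u i) * y + (q * s ^ 2) * y ^ 2))]
  apply ENNReal.ofReal_le_ofReal
  calc _ ≤ ∏ i : Fin d, Real.exp (2 * (-p * s * u i) ^ 2 + 4 * (q * s ^ 2)) :=
        Finset.prod_le_prod (fun i _ => integral_nonneg fun x => (Real.exp_pos _).le)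
          fun i _ => (hone i).2
    _ = _ := by
        rw [← Real.exp_sum, Finset.sum_add_distrib, EuclideanSpace.real_norm_sq_eq]
        congr 1
        simp only [mul_pow, ← Finset.mul_sum, Finset.sum_const, Finset.card_univ, Fintype.card_fin,
          nsmul_eq_mul, neg_sq]
        ring

end Gaussian

/-! ### Recursions driven by independent inputs, and a Chernoff bound -/

section Recursion

variable {Ω E T : Type*} [MeasurableSpace Ω] [MeasurableSpace E] [MeasurableSpace T]
  {P : Measure Ω} {Y : ℕ → Ω → E} {H : ℕ → Ω → T} {step : T × E → T}

lemma measurable_of_recursion (hY : ∀ k, Measurable (Y k)) (hstep : Measurable step) {t₀ : T}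
    (h0 : ∀ ω, H 0 ω = t₀) (hH : ∀ k ω, H (k + 1) ω = step (H k ω, Y k ω)) (k : ℕ) :
    Measurable (H k) := by
  induction k with
  | zero =>
    have : H 0 = fun _ => t₀ := funext h0
    exact this ▸ measurable_const
  | succ k ih =>
    have : H (k + 1) = fun ω => step (H k ω, Y k ω) := funext (hH k)
    exact this ▸ hstep.comp (ih.prodMk (hY k))

/-- The state of a recursion driven by independent inputs is independent of the next input. -/
lemma indepFun_of_recursion (hY : ∀ k, Measurable (Y k)) (hind : iIndepFun Y P)
    (hstep : Measurable step) {t₀ : T} (h0 : ∀ ω, H 0 ω = t₀)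
    (hH : ∀ k ω, H (k + 1) ω = step (H k ω, Y k ω)) (k : ℕ) : IndepFun (H k) (Y k) P := by
  set m : ℕ → MeasurableSpace Ω := fun i => MeasurableSpace.comap (Y i) inferInstance with hm
  -- States up to time `k` are functions of the inputs before time `k` only.
  have hmeas : ∀ j, j ≤ k → Measurable[⨆ i ∈ Set.Iio k, m i] (H j) := by
    intro j
    induction j with
    | zero =>
      intro _
      have : H 0 = fun _ => t₀ := funext h0
      rw [this]
      exact measurable_const
    | succ j ih =>
      intro hj
      have h1 := ih (by omega)
      have h2 : Measurable[⨆ i ∈ Set.Iio k, m i] (Y j) :=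
        (comap_measurable (Y j)).mono (le_biSup m (Set.mem_Iio.2 hj)) le_rfl
      have : H (j + 1) = fun ω => step (H j ω, Y j ω) := funext (hH j)
      rw [this]
      exact hstep.comp (h1.prodMk h2)
  have hI : Indep (⨆ i ∈ Set.Iio k, m i) (⨆ i ∈ ({k} : Set ℕ), m i) P :=
    indep_iSup_of_disjoint (fun i => (hY i).comap_le) hind (by simp)
  rw [IndepFun_iff_Indep]
  refine indep_of_indep_of_le_left (indep_of_indep_of_le_right hI ?_) (hmeas k le_rfl).comap_le
  exact le_biSup m (Set.mem_singleton k)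

variable [IsProbabilityMeasure P]

/-- Supermartingale argument: integrating over the newest input with the past frozen costs a factor
`B`. -/
lemma lintegral_prod_of_recursion_le {ν : Measure E} [SFinite ν] (hY : ∀ k, Measurable (Y k))
    (hlaw : ∀ k, P.map (Y k) = ν) (hind : iIndepFun Y P) (hstep : Measurable step) {t₀ : T}
    (h0 : ∀ ω, H 0 ω = t₀) (hH : ∀ k ω, H (k + 1) ω = step (H k ω, Y k ω))
    {h : T × E → ENNReal} (hh : Measurable h) {B : ENNReal}
    (hB : ∀ t, ∫⁻ y, h (t, y) ∂ν ≤ B) (k : ℕ) :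
    ∫⁻ ω, ∏ j ∈ Finset.range k, h (H j ω, Y j ω) ∂P ≤ B ^ k := by
  -- The state together with the running product is again a recursion, so the pair is independent of
  -- the next input.
  set G : ℕ → Ω → T × ENNReal := fun k ω => (H k ω, ∏ j ∈ Finset.range k, h (H j ω, Y j ω))
    with hG
  set gstep : (T × ENNReal) × E → T × ENNReal :=
    fun z => (step (z.1.1, z.2), z.1.2 * h (z.1.1, z.2)) with hgstep
  have hgm : Measurable gstep := by
    refine Measurable.prodMk (hstep.comp (by fun_prop)) (Measurable.mul (by fun_prop) ?_)
    exact hh.comp (by fun_prop)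
  have hG0 : ∀ ω, G 0 ω = (t₀, 1) := fun ω => by simp [hG, h0]
  have hGs : ∀ k ω, G (k + 1) ω = gstep (G k ω, Y k ω) := fun k ω => by
    simp [hG, hgstep, hH, Finset.prod_range_succ]
  induction k with
  | zero => simp
  | succ k ih =>
    have hGk := measurable_of_recursion hY hgm hG0 hGs k
    have hi := indepFun_of_recursion hY hind hgm hG0 hGs k
    have hjoint : P.map (fun ω => (G k ω, Y k ω)) = (P.map (G k)).prod ν := by
      rw [(indepFun_iff_map_prod_eq_prod_map_map hGk.aemeasurable (hY k).aemeasurable).1 hi,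
        hlaw]
    have hF : Measurable fun z : (T × ENNReal) × E => z.1.2 * h (z.1.1, z.2) :=
      Measurable.mul (by fun_prop) (hh.comp (by fun_prop))
    calc ∫⁻ ω, ∏ j ∈ Finset.range (k + 1), h (H j ω, Y j ω) ∂P
        = ∫⁻ z, z.1.2 * h (z.1.1, z.2) ∂(P.map (fun ω => (G k ω, Y k ω))) := by
          rw [lintegral_map hF (hGk.prodMk (hY k))]
          simp [hG, Finset.prod_range_succ]
      _ = ∫⁻ g, ∫⁻ y, g.2 * h (g.1, y) ∂ν ∂(P.map (G k)) := by
          rw [hjoint, lintegral_prod _ hF.aemeasurable]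
      _ ≤ ∫⁻ g, g.2 * B ∂(P.map (G k)) := by
          refine lintegral_mono fun g => ?_
          rw [lintegral_const_mul (f := fun y => h (g.1, y)) _ (by fun_prop)]
          gcongr
          exact hB _
      _ = (∫⁻ ω, ∏ j ∈ Finset.range k, h (H j ω, Y j ω) ∂P) * B := by
          rw [lintegral_mul_const _ (by fun_prop), lintegral_map (by fun_prop) hGk]
      _ ≤ B ^ (k + 1) := by rw [pow_succ]; gcongr

/-- Chernoff bound, uniformly over the first `K` steps, for additive functionals of a recursion
with a bounded conditional exponential moment. -/
lemma measure_exists_sum_ge_le {ν : Measure E} [SFinite ν] (hY : ∀ k, Measurable (Y k))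
    (hlaw : ∀ k, P.map (Y k) = ν) (hind : iIndepFun Y P) (hstep : Measurable step) {t₀ : T}
    (h0 : ∀ ω, H 0 ω = t₀) (hH : ∀ k ω, H (k + 1) ω = step (H k ω, Y k ω))
    {Z : T × E → ℝ} (hZ : Measurable Z) {K : ℕ} (hK : 1 ≤ K) {l : ℝ} (hl : 0 ≤ l)
    (hB : ∀ t, ∫⁻ y, ENNReal.ofReal (Real.exp (Z (t, y))) ∂ν ≤
      ENNReal.ofReal (Real.exp (l / K))) :
    P {ω | ∃ k ≤ K, 1 ≤ k ∧ 2 * l ≤ ∑ j ∈ Finset.range k, Z (H j ω, Y j ω)}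
      ≤ ENNReal.ofReal (K * Real.exp (-l)) := by
  -- The exponential of the sum has mean at most `exp l` since `k ≤ K`; Markov's inequality at `exp
  -- (2 * l)` leaves `exp (-l)`.
  have hone : ∀ k ≤ K, P {ω | 2 * l ≤ ∑ j ∈ Finset.range k, Z (H j ω, Y j ω)}
      ≤ ENNReal.ofReal (Real.exp (-l)) := by
    intro k hk
    have h1 := lintegral_prod_of_recursion_le hY hlaw hind hstep h0 hH
      (h := fun z => ENNReal.ofReal (Real.exp (Z z))) (by fun_prop) hB k
    have e1 : ∀ ω, ∏ j ∈ Finset.range k, ENNReal.ofReal (Real.exp (Z (H j ω, Y j ω)))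
        = ENNReal.ofReal (Real.exp (∑ j ∈ Finset.range k, Z (H j ω, Y j ω))) := fun ω => by
      rw [Real.exp_sum, ENNReal.ofReal_prod_of_nonneg fun i _ => (Real.exp_pos _).le]
    have e2 : ENNReal.ofReal (Real.exp (l / K)) ^ k ≤ ENNReal.ofReal (Real.exp l) := by
      rw [← ENNReal.ofReal_pow (Real.exp_pos _).le, ← Real.exp_nat_mul]
      apply ENNReal.ofReal_le_ofReal
      apply Real.exp_le_exp.2
      have hK0 : (0 : ℝ) < K := by exact_mod_cast hK
      have hkK : (k : ℝ) ≤ K := by exact_mod_cast hk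
      rw [mul_div_assoc', div_le_iff₀ hK0, mul_comm]
      gcongr
    have hmeas : Measurable fun ω =>
        ENNReal.ofReal (Real.exp (∑ j ∈ Finset.range k, Z (H j ω, Y j ω))) := by
      have := fun j => hZ.comp ((measurable_of_recursion hY hstep h0 hH j).prodMk (hY j))
      refine ENNReal.measurable_ofReal.comp (Real.measurable_exp.comp ?_)
      exact Finset.measurable_sum _ fun j _ => this j
    simp only [e1] at h1
    have hM := mul_meas_ge_le_lintegral₀ (μ := P) hmeas.aemeasurable
      (ENNReal.ofReal (Real.exp (2 * l)))
    have hsub : {ω | 2 * l ≤ ∑ j ∈ Finset.range k, Z (H j ω, Y j ω)} ⊆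
        {ω | ENNReal.ofReal (Real.exp (2 * l)) ≤
          ENNReal.ofReal (Real.exp (∑ j ∈ Finset.range k, Z (H j ω, Y j ω)))} :=
      fun ω hω => ENNReal.ofReal_le_ofReal (Real.exp_le_exp.2 hω)
    have h2 : ENNReal.ofReal (Real.exp (2 * l)) *
        P {ω | 2 * l ≤ ∑ j ∈ Finset.range k, Z (H j ω, Y j ω)} ≤ ENNReal.ofReal (Real.exp l) :=
      (by gcongr : _ ≤ _).trans (hM.trans (h1.trans e2))
    have h3 : ENNReal.ofReal (Real.exp l)
        = ENNReal.ofReal (Real.exp (2 * l)) * ENNReal.ofReal (Real.exp (-l)) := by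
      rw [← ENNReal.ofReal_mul (Real.exp_pos _).le, ← Real.exp_add]; congr 2; ring
    rw [h3] at h2
    exact (ENNReal.mul_le_mul_iff_right (by simp [Real.exp_pos]) ENNReal.ofReal_ne_top).1 h2
  -- Leaving out `k = 0` makes this a union of exactly `K` events.
  calc _ ≤ P (⋃ k ∈ Finset.Icc 1 K, {ω | 2 * l ≤ ∑ j ∈ Finset.range k, Z (H j ω, Y j ω)}) := by
        apply measure_mono
        rintro ω ⟨k, hk, hk1, hω⟩
        exact Set.mem_biUnion (Finset.mem_Icc.2 ⟨hk1, hk⟩) hω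
    _ ≤ ∑ k ∈ Finset.Icc 1 K, P {ω | 2 * l ≤ ∑ j ∈ Finset.range k, Z (H j ω, Y j ω)} :=
        measure_biUnion_finset_le _ _
    _ ≤ ∑ _k ∈ Finset.Icc 1 K, ENNReal.ofReal (Real.exp (-l)) :=
        Finset.sum_le_sum fun k hk => hone k (Finset.mem_Icc.1 hk).2
    _ = _ := by
        rw [Finset.sum_const, Nat.card_Icc, Nat.add_sub_cancel, nsmul_eq_mul,
          ENNReal.ofReal_mul (Nat.cast_nonneg K), ENNReal.ofReal_natCast]

end Recursion

/-! ### Deterministic descent inequality near the minimizer -/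

section Descent

variable {d : ℕ} {f : Vec d → ℝ} {xs : Vec d} {L R : ℝ}

lemma gradient_eq_zero_of_isMinOn (hR : 0 < R) (hmin : IsMinOn f (Metric.closedBall xs (2 * R)) xs) :
    ∇ f xs = 0 := by
  have h : IsLocalMin f xs := hmin.isLocalMin (Metric.closedBall_mem_nhds xs (by linarith))
  simp [gradient, h.fderiv_eq_zero]

lemma norm_gradient_le (hR : 0 < R) (hmin : IsMinOn f (Metric.closedBall xs (2 * R)) xs)
    (hs : SmoothOn f L (Metric.closedBall xs (2 * R))) {x : Vec d}
    (hx : x ∈ Metric.closedBall xs (2 * R)) : ‖∇ f x‖ ≤ L * ‖x - xs‖ := by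
  have := hs.2 x hx xs (Metric.mem_closedBall_self (by linarith))
  rwa [gradient_eq_zero_of_isMinOn hR hmin, sub_zero] at this

/-- By convexity the gap is at most `‖∇ f x‖ ‖x - xs‖`. This bound on the initial gap settles the
cases `K ≤ 2` and `R = 0` of the theorem. -/
lemma sub_le_of_norm_sub_le (hL : 0 < L) (h0 : 0 ≤ R)
    (hmin : IsMinOn f (Metric.closedBall xs (2 * R)) xs)
    (hs : SmoothOn f L (Metric.closedBall xs (2 * R)))
    (hc : FirstOrderConvexOn f (Metric.closedBall xs (2 * R))) {x : Vec d}
    (hx : ‖x - xs‖ ≤ R) : f x - f xs ≤ L * R ^ 2 := by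
  rcases h0.eq_or_lt with rfl | hR
  · have : x = xs := sub_eq_zero.1 (norm_le_zero_iff.1 hx)
    simp [this]
  have hxm : x ∈ Metric.closedBall xs (2 * R) := by
    rw [mem_closedBall_iff_norm]; linarith
  have h1 := hc x hxm xs (Metric.mem_closedBall_self (by linarith))
  have h2 := norm_gradient_le hR hmin hs hxm
  have h3 := abs_le.1 (abs_real_inner_le_norm (∇ f x) (xs - x))
  rw [norm_sub_rev xs x] at h3
  have h4 : ‖∇ f x‖ * ‖x - xs‖ ≤ (L * R) * R := by gcongr; exact h2.trans (by gcongr)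
  nlinarith [h3.1]

/-- The squared gradient norm is controlled by the function gap. -/
lemma norm_gradient_sq_le (hL : 0 < L) (hR : 0 < R)
    (hmin : IsMinOn f (Metric.closedBall xs (2 * R)) xs)
    (hs : SmoothOn f L (Metric.closedBall xs (2 * R)))
    (hc : FirstOrderConvexOn f (Metric.closedBall xs (2 * R))) {x : Vec d}
    (hx : ‖x - xs‖ ≤ 3 / 2 * R) : 2 * ‖∇ f x‖ ^ 2 ≤ 9 * L * (f x - f xs) := by
  set g := ∇ f x with hg
  have hxm : x ∈ Metric.closedBall xs (2 * R) := by
    rw [mem_closedBall_iff_norm]; linarith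
  have hgn : ‖g‖ ≤ L * ‖x - xs‖ := norm_gradient_le hR hmin hs hxm
  -- A gradient step of this length moves `x` by at most `‖x - xs‖ / 3 ≤ R / 2`, so `y` stays in the
  -- ball of radius `2 R`.
  set η := (3 * L)⁻¹ with hη
  have hη0 : 0 < η := by positivity
  have hηL : η * L = 1 / 3 := by rw [hη]; field_simp
  set y := x - η • g with hy
  have hxy : x - y = η • g := by rw [hy]; abel
  have hng : ‖η • g‖ = η * ‖g‖ := by rw [norm_smul, Real.norm_of_nonneg hη0.le]
  have hym : y ∈ Metric.closedBall xs (2 * R) := by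
    rw [mem_closedBall_iff_norm]
    have e : y - xs = (x - xs) - η • g := by rw [hy]; abel
    rw [e]
    have h1 := norm_sub_le (x - xs) (η • g)
    have h2 : η * ‖g‖ ≤ η * (L * ‖x - xs‖) := by gcongr
    rw [hng] at h1
    rw [← mul_assoc, hηL] at h2
    linarith
  -- Convexity is applied at `y`, and the Lipschitz bound turns `∇ f y` back into `g`; no
  -- integration along the segment is needed.
  have h1 := hc y hym x hxm
  have h2 : f xs ≤ f y := hmin hym
  have h3 := hs.2 y hym x hxm
  rw [norm_sub_rev y x, hxy, hng] at h3
  have h4 : inner ℝ (∇ f y) (x - y) = η * ‖g‖ ^ 2 + η * inner ℝ (∇ f y - g) g := by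
    rw [hxy, inner_smul_right, ← real_inner_self_eq_norm_sq, ← mul_add, ← inner_add_left]
    congr 2
    abel
  have h5 := (abs_le.1 (abs_real_inner_le_norm (∇ f y - g) g)).1
  have h6 : ‖∇ f y - g‖ * ‖g‖ ≤ 1 / 3 * ‖g‖ ^ 2 := by
    calc _ ≤ L * (η * ‖g‖) * ‖g‖ := by gcongr
      _ = (η * L) * ‖g‖ ^ 2 := by ring
      _ = _ := by rw [hηL]
  have h7 : η * (2 / 3 * ‖g‖ ^ 2) ≤ f x - f xs := by
    have : η * (2 / 3 * ‖g‖ ^ 2) ≤ η * (‖g‖ ^ 2 + inner ℝ (∇ f y - g) g) := by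
      gcongr; linarith
    linarith
  have h8 : 9 * L * (η * (2 / 3 * ‖g‖ ^ 2)) = 2 * ‖g‖ ^ 2 := by
    calc _ = (η * L) * (6 * ‖g‖ ^ 2) := by ring
      _ = _ := by rw [hηL]; ring
  rw [← h8]
  gcongr

lemma norm_add_four_sq_le (a b c e : Vec d) :
    ‖a + b + c + e‖ ^ 2 ≤ 4 * (‖a‖ ^ 2 + ‖b‖ ^ 2 + ‖c‖ ^ 2 + ‖e‖ ^ 2) := by
  have h : ‖a + b + c + e‖ ≤ ‖a‖ + ‖b‖ + ‖c‖ + ‖e‖ := norm_add₄_le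
  have h2 : ‖a + b + c + e‖ ^ 2 ≤ (‖a‖ + ‖b‖ + ‖c‖ + ‖e‖) ^ 2 := by gcongr
  nlinarith [sq_nonneg (‖a‖ - ‖b‖), sq_nonneg (‖a‖ - ‖c‖), sq_nonneg (‖a‖ - ‖e‖),
    sq_nonneg (‖b‖ - ‖c‖), sq_nonneg (‖b‖ - ‖e‖), sq_nonneg (‖c‖ - ‖e‖)]

/-- The part of the one-step progress that is due to the noise `θ` of the clipped gradient and to
the noise `w` added for privacy. -/
noncomputable def noiseTerm (γ : ℝ) (u θ w : Vec d) : ℝ :=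
  -(2 * γ) * inner ℝ u θ + 4 * γ ^ 2 * ‖θ‖ ^ 2
    + (-(2 * γ) * inner ℝ u w + 4 * γ ^ 2 * ‖w‖ ^ 2)

/-- One step of the method; `G` is the mean of the clipped stochastic gradient `G + θ`. -/
lemma norm_step_sq_le (hL : 0 < L) (hR : 0 < R)
    (hmin : IsMinOn f (Metric.closedBall xs (2 * R)) xs)
    (hs : SmoothOn f L (Metric.closedBall xs (2 * R)))
    (hc : FirstOrderConvexOn f (Metric.closedBall xs (2 * R))) {x : Vec d}
    (hx : ‖x - xs‖ ^ 2 ≤ 2 * R ^ 2) {γ b : ℝ} {G : Vec d} (hγ : 0 ≤ γ)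
    (hγL : γ * L ≤ 1 / 18) (hG : ‖G - ∇ f x‖ ≤ b) (θ w : Vec d) :
    ‖x - γ • (G + θ + w) - xs‖ ^ 2 + γ * (f x - f xs) ≤ ‖x - xs‖ ^ 2
      + noiseTerm γ (x - xs) θ w + (3 * R * (γ * b) + 4 * (γ * b) ^ 2) := by
  have hb : 0 ≤ b := (norm_nonneg _).trans hG
  have hx' : ‖x - xs‖ ≤ 3 / 2 * R := by
    apply le_of_sq_le_sq _ (by positivity)
    nlinarith
  have hxm : x ∈ Metric.closedBall xs (2 * R) := by
    rw [mem_closedBall_iff_norm]; linarith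
  have hgs := norm_gradient_sq_le hL hR hmin hs hc hx'
  have hcv := hc x hxm xs (Metric.mem_closedBall_self (by linarith))
  set g := ∇ f x with hg
  set e := G - g with he
  set u := x - xs with hu
  have hcv' : f x - f xs ≤ inner ℝ u g := by
    have : inner ℝ g (xs - x) = - inner ℝ u g := by
      rw [real_inner_comm, ← neg_sub, inner_neg_left]
    linarith
  have hstep : x - γ • (G + θ + w) - xs = u - γ • (g + e + θ + w) := by
    rw [he, hu]; module
  have hue : - (3 / 2 * R * b) ≤ inner ℝ u e := by
    have h1 := (abs_le.1 (abs_real_inner_le_norm u e)).1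
    have h2 : ‖u‖ * ‖e‖ ≤ 3 / 2 * R * b := by gcongr
    linarith
  have h4 := norm_add_four_sq_le g e θ w
  have he2 : ‖e‖ ^ 2 ≤ b ^ 2 := by gcongr
  have hgap : 0 ≤ f x - f xs := sub_nonneg.2 (hmin hxm)
  -- The inner product with `g` yields `2 γ (f x - f xs)`. Half of it absorbs the squared gradient,
  -- which is where `γ L ≤ 1 / 18` enters.
  have hquad : γ ^ 2 * (4 * ‖g‖ ^ 2) ≤ γ * (f x - f xs) := by
    calc γ ^ 2 * (4 * ‖g‖ ^ 2) ≤ γ ^ 2 * (2 * (9 * L * (f x - f xs))) :=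
          mul_le_mul_of_nonneg_left (by linarith) (sq_nonneg γ)
      _ = γ * (18 * (γ * L) * (f x - f xs)) := by ring
      _ ≤ γ * (1 * (f x - f xs)) := by gcongr; linarith
      _ = _ := by ring
  rw [hstep, norm_sub_sq_real, norm_smul, Real.norm_of_nonneg hγ, mul_pow, inner_smul_right,
    inner_add_right, inner_add_right, inner_add_right, noiseTerm]
  have h5 : γ ^ 2 * ‖g + e + θ + w‖ ^ 2
      ≤ γ ^ 2 * (4 * ‖g‖ ^ 2) + γ ^ 2 * (4 * b ^ 2) + 4 * γ ^ 2 * ‖θ‖ ^ 2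
        + 4 * γ ^ 2 * ‖w‖ ^ 2 := by
    calc _ ≤ γ ^ 2 * (4 * (‖g‖ ^ 2 + b ^ 2 + ‖θ‖ ^ 2 + ‖w‖ ^ 2)) := by
          gcongr; linarith
      _ = _ := by ring
  have h6 := mul_le_mul_of_nonneg_left hcv' hγ
  have h7 := mul_le_mul_of_nonneg_left hue hγ
  linarith

/-- If the accumulated noise stays below `R² / 2`, the iterates stay in the ball of radius `√2 R`
and the function gaps are summable. -/
lemma sum_gap_le {x G θ w : ℕ → Vec d} {γ b : ℝ} {K : ℕ} (hL : 0 < L) (hR : 0 < R)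
    (hmin : IsMinOn f (Metric.closedBall xs (2 * R)) xs)
    (hs : SmoothOn f L (Metric.closedBall xs (2 * R)))
    (hc : FirstOrderConvexOn f (Metric.closedBall xs (2 * R))) (hx0 : ‖x 0 - xs‖ ≤ R)
    (hstep : ∀ k, x (k + 1) = x k - γ • (G k + θ k + w k)) (hγ : 0 ≤ γ)
    (hγL : γ * L ≤ 1 / 18) (hG : ∀ k, ‖x k - xs‖ ^ 2 ≤ 2 * R ^ 2 → ‖G k - ∇ f (x k)‖ ≤ b)
    (hb : K * (3 * R * (γ * b) + 4 * (γ * b) ^ 2) ≤ R ^ 2 / 2) (hb0 : 0 ≤ b)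
    (hnoise : ∀ k ≤ K, (∀ j < k, ‖x j - xs‖ ^ 2 ≤ 2 * R ^ 2) →
      ∑ j ∈ Finset.range k, noiseTerm γ (x j - xs) (θ j) (w j) ≤ R ^ 2 / 2) :
    γ * ∑ j ∈ Finset.range K, (f (x j) - f xs) ≤ 2 * R ^ 2 := by
  set q := 3 * R * (γ * b) + 4 * (γ * b) ^ 2 with hq
  have hq0 : 0 ≤ q := by positivity
  -- The noise bound at time `k` presupposes only that earlier iterates lie in the ball. It places
  -- `x k` there, since `R² + R² / 2 + R² / 2 = 2 R²` and the sum of gaps is nonnegative; this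
  -- permits the next step.
  have key : ∀ k ≤ K, (∀ j < k, ‖x j - xs‖ ^ 2 ≤ 2 * R ^ 2) ∧
      ‖x k - xs‖ ^ 2 + γ * ∑ j ∈ Finset.range k, (f (x j) - f xs)
        ≤ R ^ 2 + ∑ j ∈ Finset.range k, noiseTerm γ (x j - xs) (θ j) (w j) + k * q ∧
      0 ≤ ∑ j ∈ Finset.range k, (f (x j) - f xs) := by
    intro k
    induction k with
    | zero =>
      intro _
      have : ‖x 0 - xs‖ ^ 2 ≤ R ^ 2 := by gcongr
      simpa using this
    | succ k ih =>
      intro hk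
      obtain ⟨hball, hle, hsum⟩ := ih (by omega)
      have hn := hnoise k (by omega) hball
      have hkK : (k : ℝ) * q ≤ K * q := by
        gcongr; omega
      have hxk : ‖x k - xs‖ ^ 2 ≤ 2 * R ^ 2 := by
        have : 0 ≤ γ * ∑ j ∈ Finset.range k, (f (x j) - f xs) := by positivity
        linarith
      have hxm : x k ∈ Metric.closedBall xs (2 * R) := by
        rw [mem_closedBall_iff_norm]
        apply le_of_sq_le_sq _ (by positivity)
        nlinarith
      have h1 := norm_step_sq_le hL hR hmin hs hc hxk hγ hγL (hG k hxk) (θ k) (w k)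
      rw [← hstep] at h1
      refine ⟨fun j hj => ?_, ?_, ?_⟩
      · rcases Nat.lt_succ_iff_lt_or_eq.1 hj with h | rfl
        · exact hball j h
        · exact hxk
      · rw [Finset.sum_range_succ, Finset.sum_range_succ, mul_add]
        push_cast
        linarith
      · rw [Finset.sum_range_succ]
        exact add_nonneg hsum (sub_nonneg.2 (hmin hxm))
  obtain ⟨hball, hle, -⟩ := key K le_rfl
  have hn := hnoise K le_rfl hball
  linarith [sq_nonneg ‖x K - xs‖]

lemma bestValue_sub_le (f : Vec d → ℝ) (x : ℕ → Vec d) {K : ℕ} (hK : 1 ≤ K) {m γ B : ℝ}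
    (hγ : 0 < γ) (h : γ * ∑ j ∈ Finset.range K, (f (x j) - m) ≤ B) :
    bestValue f x K - m ≤ B / (γ * K) := by
  have hK0 : (0 : ℝ) < K := by exact_mod_cast hK
  have h1 : ∑ _j ∈ Finset.range K, (bestValue f x K - m)
      ≤ ∑ j ∈ Finset.range K, (f (x j) - m) := by
    refine Finset.sum_le_sum fun j hj => sub_le_sub_right ?_ m
    exact Finset.inf'_le _ (Finset.mem_range.2 (by have := Finset.mem_range.1 hj; omega))
  rw [Finset.sum_const, Finset.card_range, nsmul_eq_mul] at h1
  rw [le_div_iff₀ (by positivity)]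
  have := mul_le_mul_of_nonneg_left h1 hγ.le
  linarith

end Descent

/-! ### Exponential moment of the noise of one step -/

section NoiseMoment

instance (d : ℕ) (s : ℝ) : IsProbabilityMeasure (gaussianNoise d s) := by
  unfold gaussianNoise; infer_instance

variable {d : ℕ} {Ξ : Type*} [MeasurableSpace Ξ] {D : Measure Ξ} [IsProbabilityMeasure D]

/-- Exponential moment of the noise in one step. -/
lemma lintegral_exp_noiseTerm_le {θ : Ξ → Vec d} {lam V R γ l σω : ℝ} {K : ℕ} {u : Vec d}
    (hθ : Measurable θ) (hM : ∀ ξ, ‖θ ξ‖ ≤ 2 * lam) (h0 : ∫ ξ, θ ξ ∂D = 0)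
    (hV : ∫ ξ, ‖θ ξ‖ ^ 2 ∂D ≤ V) (hV0 : 0 ≤ V) (hd : 1 ≤ d) (hK : 1 ≤ K) (hR : 0 < R) (hγ : 0 ≤ γ)
    (hlam : 0 < lam) (hl : 1 ≤ l) (hu : ‖u‖ ^ 2 ≤ 2 * R ^ 2)
    (hγV : γ ^ 2 * V * (K * l) ≤ 4 * (R / 100) ^ 2) (hγl : γ * lam * l ≤ R / 100)
    (hγσ : γ ^ 2 * σω ^ 2 * (d * K * l) ≤ (R / 100) ^ 2) :
    ∫⁻ y, ENNReal.ofReal (Real.exp (4 * l / R ^ 2 * noiseTerm γ u (θ y.1) y.2))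
        ∂(D.prod (gaussianNoise d σω))
      ≤ ENNReal.ofReal (Real.exp (l / K)) := by
  -- With this scale the noise budget `R ^ 2 / 2` becomes the Chernoff threshold `2 * l`.
  set s := 4 * l / R ^ 2 with hs
  have hd1 : (1 : ℝ) ≤ d := by exact_mod_cast hd
  have hK1 : (1 : ℝ) ≤ K := by exact_mod_cast hK
  have hs0 : 0 ≤ s := by positivity
  have hu' : ‖u‖ ≤ 3 / 2 * R := by
    apply le_of_sq_le_sq _ (by positivity)
    nlinarith
  have hγlam0 : 0 ≤ γ * lam := by positivity
  have hγlam : γ * lam ≤ R / 100 := le_trans (le_mul_of_one_le_right hγlam0 hl) hγl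
  have hpq : 2 * s * γ * ‖u‖ * (2 * lam) + 4 * s * γ ^ 2 * (2 * lam) ^ 2 ≤ 1 := by
    have h1 : 2 * s * γ * ‖u‖ * (2 * lam) ≤ 6 * (s * (γ * lam) * R) := by
      calc _ = 4 * (s * (γ * lam)) * ‖u‖ := by ring
        _ ≤ 4 * (s * (γ * lam)) * (3 / 2 * R) := by gcongr
        _ = _ := by ring
    have h2 : 4 * s * γ ^ 2 * (2 * lam) ^ 2 ≤ 1 / 5 * (s * (γ * lam) * R) := by
      calc _ = 16 * (s * (γ * lam)) * (γ * lam) := by ring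
        _ ≤ 16 * (s * (γ * lam)) * (R / 100) := by gcongr
        _ ≤ _ := by nlinarith [mul_nonneg (mul_nonneg hs0 hγlam0) hR.le]
    have h3 : s * (γ * lam) * R ≤ 4 / 100 := by
      have : s * (γ * lam) * R = 4 * (γ * lam * l) / R := by rw [hs]; field_simp
      rw [this, div_le_iff₀ hR]
      linarith
    linarith
  have hA := lintegral_exp_inner_le hθ.aestronglyMeasurable hM h0 hV u
    (p := 2 * s * γ) (q := 4 * s * γ ^ 2) (by positivity) (by positivity) hpq
  have hKl : 0 < K * R ^ 2 := by positivity
  -- The clipped gradient and the Gaussian noise each receive half of the exponent `l / K`.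
  have hexpA : (4 * s * γ ^ 2 + 2 * ((2 * s * γ) ^ 2 * ‖u‖ ^ 2
      + (4 * s * γ ^ 2) ^ 2 * (2 * lam) ^ 2)) * V ≤ l / (2 * K) := by
    have h1 : 4 * s + 8 * s ^ 2 * ‖u‖ ^ 2 + 128 * s ^ 2 * (γ * lam) ^ 2
        ≤ 300 * (l ^ 2 / R ^ 2) := by
      have e1 : 8 * s ^ 2 * ‖u‖ ^ 2 ≤ 256 * (l ^ 2 / R ^ 2) := by
        calc _ ≤ 8 * s ^ 2 * (2 * R ^ 2) := by gcongr
          _ = _ := by rw [hs]; field_simp; norm_num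
      have e2 : 128 * s ^ 2 * (γ * lam) ^ 2 ≤ (l ^ 2 / R ^ 2) := by
        calc _ ≤ 128 * s ^ 2 * (R / 100) ^ 2 := by gcongr
          _ = 128 * 16 / 10000 * (l ^ 2 / R ^ 2) := by rw [hs]; field_simp; norm_num
          _ ≤ 1 * (l ^ 2 / R ^ 2) := by gcongr; norm_num
          _ = _ := one_mul _
      have e3 : 4 * s ≤ 16 * (l ^ 2 / R ^ 2) := by
        rw [hs, mul_div_assoc', mul_div_assoc', div_le_div_iff_of_pos_right (by positivity)]
        nlinarith
      have e4 : 0 ≤ l ^ 2 / R ^ 2 := by positivity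
      linarith
    calc _ = (4 * s + 8 * s ^ 2 * ‖u‖ ^ 2 + 128 * s ^ 2 * (γ * lam) ^ 2) * (γ ^ 2 * V) := by ring
      _ ≤ 300 * (l ^ 2 / R ^ 2) * (γ ^ 2 * V) := by gcongr
      _ = 300 * l / (K * R ^ 2) * (γ ^ 2 * V * (K * l)) := by field_simp
      _ ≤ 300 * l / (K * R ^ 2) * (4 * (R / 100) ^ 2) := by gcongr
      _ = 1200 / 10000 * (l / K) := by field_simp; norm_num
      _ ≤ 1 / 2 * (l / K) := mul_le_mul_of_nonneg_right (by norm_num) (by positivity)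
      _ = _ := by field_simp
  have hγσ0 : 0 ≤ γ ^ 2 * σω ^ 2 := by positivity
  have hqs : 4 * s * γ ^ 2 * σω ^ 2 ≤ 1 / 8 := by
    have h1 : γ ^ 2 * σω ^ 2 * l ≤ γ ^ 2 * σω ^ 2 * (d * K * l) := by
      gcongr
      have : (1 : ℝ) ≤ d * K := by nlinarith
      nlinarith
    calc _ = 16 / R ^ 2 * (γ ^ 2 * σω ^ 2 * l) := by rw [hs]; field_simp; ring
      _ ≤ 16 / R ^ 2 * (R / 100) ^ 2 := by gcongr; exact h1.trans hγσ
      _ = 16 / 10000 := by field_simp; norm_num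
      _ ≤ _ := by norm_num
  have hB := lintegral_exp_gaussianNoise_le (p := 2 * s * γ) (q := 4 * s * γ ^ 2) (s := σω)
    (by positivity) hqs u
  have hexpB : 2 * (2 * s * γ) ^ 2 * σω ^ 2 * ‖u‖ ^ 2 + 4 * d * (4 * s * γ ^ 2 * σω ^ 2)
      ≤ l / (2 * K) := by
    have e1 : 8 * s ^ 2 * ‖u‖ ^ 2 ≤ 256 * (d * l ^ 2 / R ^ 2) := by
      calc _ ≤ 8 * s ^ 2 * (2 * R ^ 2) := by gcongr
        _ = 256 * (1 * l ^ 2 / R ^ 2) := by rw [hs]; field_simp; norm_num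
        _ ≤ _ := by gcongr
    have e2 : 16 * d * s ≤ 64 * (d * l ^ 2 / R ^ 2) := by
      calc _ = 64 * (d * (l * 1) / R ^ 2) := by rw [hs]; field_simp; norm_num
        _ ≤ 64 * (d * (l * l) / R ^ 2) := by gcongr
        _ = _ := by ring
    calc _ = (8 * s ^ 2 * ‖u‖ ^ 2 + 16 * d * s) * (γ ^ 2 * σω ^ 2) := by ring
      _ ≤ (320 * (d * l ^ 2 / R ^ 2)) * (γ ^ 2 * σω ^ 2) := by gcongr; linarith
      _ = 320 * l / (K * R ^ 2) * (γ ^ 2 * σω ^ 2 * (d * K * l)) := by field_simp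
      _ ≤ 320 * l / (K * R ^ 2) * (R / 100) ^ 2 := by gcongr
      _ = 320 / 10000 * (l / K) := by field_simp; norm_num
      _ ≤ 1 / 2 * (l / K) := mul_le_mul_of_nonneg_right (by norm_num) (by positivity)
      _ = _ := by field_simp
  have hsplit : ∀ y : Ξ × Vec d,
      ENNReal.ofReal (Real.exp (s * noiseTerm γ u (θ y.1) y.2))
        = ENNReal.ofReal (Real.exp (-(2 * s * γ) * inner ℝ u (θ y.1)
            + 4 * s * γ ^ 2 * ‖θ y.1‖ ^ 2))
          * ENNReal.ofReal (Real.exp (-(2 * s * γ) * inner ℝ u y.2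
            + 4 * s * γ ^ 2 * ‖y.2‖ ^ 2)) := by
    intro y
    rw [← ENNReal.ofReal_mul (Real.exp_pos _).le, ← Real.exp_add, noiseTerm]
    congr 2
    ring
  -- Sample and privacy noise are independent, so the exponential moment factors.
  simp only [hsplit]
  rw [lintegral_prod_mul
    (f := fun z => ENNReal.ofReal (Real.exp (-(2 * s * γ) * inner ℝ u (θ z)
      + 4 * s * γ ^ 2 * ‖θ z‖ ^ 2)))
    (g := fun z => ENNReal.ofReal (Real.exp (-(2 * s * γ) * inner ℝ u z
      + 4 * s * γ ^ 2 * ‖z‖ ^ 2))) (by fun_prop) (by fun_prop)]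
  calc _ ≤ ENNReal.ofReal (Real.exp (l / (2 * K))) * ENNReal.ofReal (Real.exp (l / (2 * K))) :=
        mul_le_mul' (hA.trans (ENNReal.ofReal_le_ofReal (Real.exp_le_exp.2 hexpA)))
          (hB.trans (ENNReal.ofReal_le_ofReal (Real.exp_le_exp.2 hexpB)))
    _ = _ := by
        rw [← ENNReal.ofReal_mul (Real.exp_pos _).le, ← Real.exp_add]
        congr 2
        ring

end NoiseMoment

/-! ### Consequences of the step-size choice -/

section StepSize

variable {d K : ℕ} {L R σ α lam β σω c : ℝ}

lemma zeta_nonneg : 0 ≤ zeta L R lam := le_max_left _ _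

lemma effNoise_pos (hσ : 0 < σ) : 0 < effNoise L R σ α lam := by
  have := zeta_nonneg (L := L) (R := R) (lam := lam)
  unfold effNoise; positivity

lemma biasFactor_pos (hL : 0 < L) (hR : 0 < R) (hσ : 0 < σ) (hlam : 0 < lam) :
    0 < biasFactor L R σ α lam := by
  have := zeta_nonneg (L := L) (R := R) (lam := lam)
  have := effNoise_pos (L := L) (R := R) (α := α) (lam := lam) hσ
  unfold biasFactor; positivity

/-- The clipping bias is of the order of `S B / lam ^ (α - 1)`. -/
lemma zeta_add_le (hL : 0 < L) (hR : 0 < R) (hσ : 0 < σ) (hlam : 0 < lam) (hα : 1 < α) :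
    zeta L R lam + 2 * lam ^ (1 - α) * σ ^ α
      ≤ 2 * (effNoise L R σ α lam * biasFactor L R σ α lam / lam ^ (α - 1)) := by
  have hζ := zeta_nonneg (L := L) (R := R) (lam := lam)
  have hS := effNoise_pos (L := L) (R := R) (α := α) (lam := lam) hσ
  set S := effNoise L R σ α lam with hSdef
  set ζ := zeta L R lam
  have hα0 : 0 < α := by linarith
  have hSσ : σ ^ α ≤ S := by
    rw [hSdef, effNoise]
    exact le_add_of_nonneg_right (by positivity)
  -- The right side is `σ * S ^ ((α - 1) / α)`, and `σ ^ α ≤ S`.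
  have h1 : σ ^ α ≤ S * (σ * S ^ (-1 / α)) := by
    have e1 : S * S ^ (-1 / α) = S ^ ((α - 1) / α) := by
      nth_rewrite 1 [← Real.rpow_one S]
      rw [← Real.rpow_add hS]
      congr 1
      field_simp
      ring
    have e2 : σ ^ (α - 1) ≤ S ^ ((α - 1) / α) := by
      calc σ ^ (α - 1) = (σ ^ α) ^ ((α - 1) / α) := by
            rw [← Real.rpow_mul hσ.le]; congr 1; field_simp
        _ ≤ _ := Real.rpow_le_rpow (by positivity) hSσ (div_nonneg (by linarith) hα0.le)
    have e3 : σ ^ α = σ * σ ^ (α - 1) := by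
      rw [Real.rpow_sub_one hσ.ne']; field_simp
    calc σ ^ α ≤ σ * S ^ ((α - 1) / α) := by rw [e3]; gcongr
      _ = S * (σ * S ^ (-1 / α)) := by rw [← e1]; ring
  have hp : 0 < lam ^ (α - 1) := by positivity
  have hinv : lam ^ (1 - α) = (lam ^ (α - 1))⁻¹ := by
    rw [← Real.rpow_neg hlam.le]; congr 1; ring
  -- The second summand of `B` reproduces `ζ`, the third dominates the heavy-tail bias, and the
  -- first is nonnegative and dropped.
  have h2 : S * (L * R / lam + lam ^ (α - 1) * ζ / S + σ * S ^ (-1 / α)) / lam ^ (α - 1)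
      = S * (L * R / lam) / lam ^ (α - 1) + ζ + S * (σ * S ^ (-1 / α)) / lam ^ (α - 1) := by
    field_simp
  have h3 : σ ^ α / lam ^ (α - 1) ≤ S * (σ * S ^ (-1 / α)) / lam ^ (α - 1) := by gcongr
  have h4 : 0 ≤ S * (L * R / lam) / lam ^ (α - 1) := by positivity
  rw [biasFactor, h2, hinv, mul_assoc, inv_mul_eq_div]
  linarith

lemma stepSizeMin_pos (hL : 0 < L) (hR : 0 < R) (hσ : 0 < σ) (hlam : 0 < lam) (hd : 1 ≤ d)
    (hK : 1 ≤ K) (hl : 0 < Real.log (K / β)) (hσω : 0 < σω) :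
    0 < stepSizeMin d K L R σ α lam β σω := by
  have := biasFactor_pos (α := α) hL hR hσ hlam
  have := effNoise_pos (L := L) (R := R) (α := α) (lam := lam) hσ
  have : (0 : ℝ) < K := by exact_mod_cast hK
  have : (0 : ℝ) < d := by exact_mod_cast hd
  unfold stepSizeMin
  refine lt_min (lt_min ?_ ?_) (lt_min ?_ ?_) <;> positivity

lemma le_mul_of_le_div {γ a r : ℝ} (ha : 0 < a) (hc : 0 ≤ c) {m : ℝ} (hγ : γ = c * m)
    (hm : m ≤ r / a) : γ * a ≤ c * r := by
  rw [hγ, mul_assoc]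
  gcongr
  exact (le_div_iff₀ ha).1 hm

/-- The consequences of the step-size condition. -/
lemma stepSize_bounds {A γ : ℝ} (hL : 0 < L) (hR : 0 < R) (hσ : 0 < σ) (hα : 1 < α) (hα2 : α ≤ 2)
    (hlam : 0 < lam)
    (hd : 1 ≤ d) (hK : 1 ≤ K) (hl : 0 < Real.log (K / β)) (hσω : 0 < σω) (hA : 0 < A) (hc : 0 < c)
    (hcA : c * max 1 A ≤ 1 / 100)
    (hlamA : lam ^ α * Real.log (K / β) ≤ A ^ α * K * effNoise L R σ α lam)
    (hγ : γ = c * stepSizeMin d K L R σ α lam β σω) :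
    γ * L ≤ 1 / 100 ∧
    γ ^ 2 * (4 * lam ^ (2 - α) * effNoise L R σ α lam) * (K * Real.log (K / β))
      ≤ 4 * (R / 100) ^ 2 ∧
    γ * lam * Real.log (K / β) ≤ R / 100 ∧
    K * (γ * (effNoise L R σ α lam * biasFactor L R σ α lam / lam ^ (α - 1))) ≤ R / 100 ∧
    γ ^ 2 * σω ^ 2 * (d * K * Real.log (K / β)) ≤ (R / 100) ^ 2 := by
  have hB := biasFactor_pos (α := α) hL hR hσ hlam
  have hS := effNoise_pos (L := L) (R := R) (α := α) (lam := lam) hσ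
  have hK0 : (0 : ℝ) < K := by exact_mod_cast hK
  have hd0 : (0 : ℝ) < d := by exact_mod_cast hd
  have hpos : 0 < γ := hγ ▸ mul_pos hc (stepSizeMin_pos hL hR hσ hlam hd hK hl hσω)
  have hc1 : c ≤ 1 / 100 := le_trans (le_mul_of_one_le_right hc.le (le_max_left _ _)) hcA
  set l := Real.log (K / β)
  set S := effNoise L R σ α lam with hSdef
  set B := biasFactor L R σ α lam with hBdef
  have h1 : stepSizeMin d K L R σ α lam β σω ≤ 1 / L := (min_le_left _ _).trans (min_le_left _ _)
  have h2 : stepSizeMin d K L R σ α lam β σω ≤ R / (lam ^ (1 - α / 2) * √(K * l * S)) :=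
    (min_le_left _ _).trans (min_le_right _ _)
  have h3 : stepSizeMin d K L R σ α lam β σω ≤ R * lam ^ (α - 1) / (K * S * B) :=
    (min_le_right _ _).trans (min_le_left _ _)
  have h4 : stepSizeMin d K L R σ α lam β σω ≤ R / (σω * √(d * K * l)) :=
    (min_le_right _ _).trans (min_le_right _ _)
  have g1 := le_mul_of_le_div hL hc.le hγ h1
  have g2 := le_mul_of_le_div (by positivity) hc.le hγ h2
  have g3 := le_mul_of_le_div (by positivity) hc.le hγ h3
  have g4 := le_mul_of_le_div (by positivity) hc.le hγ h4
  have hcR : c * R ≤ R / 100 := by nlinarith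
  have e2 : (γ * (lam ^ (1 - α / 2) * √(K * l * S))) ^ 2
      = γ ^ 2 * (lam ^ (2 - α) * S) * (K * l) := by
    have : (lam ^ (1 - α / 2)) ^ 2 = lam ^ (2 - α) := by
      rw [← Real.rpow_natCast, ← Real.rpow_mul hlam.le]; congr 1; push_cast; ring
    rw [mul_pow, mul_pow, Real.sq_sqrt (by positivity), this]; ring
  have q2 : γ ^ 2 * (lam ^ (2 - α) * S) * (K * l) ≤ (c * R) ^ 2 := by
    rw [← e2]; gcongr
  refine ⟨by linarith, ?_, ?_, ?_, ?_⟩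
  · have : (c * R) ^ 2 ≤ (R / 100) ^ 2 := by gcongr
    linarith
  -- Here the range of admissible clipping levels enters: it converts one factor `lam ^ α * l` of
  -- the square into `A ^ α * K * S`, which the stochastic entry of the minimum controls.
  · apply le_of_sq_le_sq _ (by positivity)
    have eα : lam ^ (2 - α) * lam ^ α = lam ^ 2 := by
      rw [← Real.rpow_add hlam]; norm_num
    -- A bound uniform in `α`, so that the smallness of `c` depends on `A` alone.
    have hAα : A ^ α ≤ max 1 A ^ 2 := by
      calc A ^ α ≤ max 1 A ^ α := by gcongr; exact le_max_right _ _
        _ ≤ max 1 A ^ (2 : ℝ) := Real.rpow_le_rpow_of_exponent_le (le_max_left _ _) hα2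
        _ = _ := by norm_num
    calc (γ * lam * l) ^ 2 = γ ^ 2 * lam ^ (2 - α) * l * (lam ^ α * l) := by
          rw [mul_pow, mul_pow, ← eα]; ring
      _ ≤ γ ^ 2 * lam ^ (2 - α) * l * (A ^ α * K * S) := by gcongr
      _ = γ ^ 2 * (lam ^ (2 - α) * S) * (K * l) * A ^ α := by ring
      _ ≤ (c * R) ^ 2 * max 1 A ^ 2 := by gcongr
      _ = (c * max 1 A * R) ^ 2 := by ring
      _ ≤ (1 / 100 * R) ^ 2 := by gcongr
      _ = _ := by ring
  · have : K * (γ * (S * B / lam ^ (α - 1))) = γ * (K * S * B) / lam ^ (α - 1) := by ring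
    rw [this, div_le_iff₀ (by positivity)]
    refine g3.trans ?_
    rw [← mul_assoc]
    gcongr
  · have e4 : (γ * (σω * √(d * K * l))) ^ 2 = γ ^ 2 * σω ^ 2 * (d * K * l) := by
      rw [mul_pow, mul_pow, Real.sq_sqrt (by positivity)]; ring
    rw [← e4]
    have := g4.trans hcR
    gcongr

/-- The rate obtained from the step-size. -/
lemma rate_le {γ a₂ ε δ : ℝ} (hL : 0 < L) (hR : 0 < R) (hσ : 0 < σ) (hlam : 0 < lam) (hd : 1 ≤ d)
    (hK : 1 ≤ K) (hl : 0 < Real.log (K / β)) (hσω : 0 < σω) (hc : 0 < c) (hε : 0 < ε)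
    (hδ : 0 < δ) (hδ1 : δ < 1) (ha₂ : 0 < a₂) (hup : σω ≤ a₂ * dpScale K lam ε δ)
    (hγ : γ = c * stepSizeMin d K L R σ α lam β σω) :
    2 * R ^ 2 / (γ * K) ≤ 2 / c * (1 + a₂) *
      max (max (detTerm K L R lam) (stochTerm K L R σ α lam β))
        (max (biasTerm L R σ α lam) (dpTerm d K L R lam β ε δ)) := by
  have hB := biasFactor_pos (α := α) hL hR hσ hlam
  have hS := effNoise_pos (L := L) (R := R) (α := α) (lam := lam) hσ
  have hK1 : (1 : ℝ) ≤ K := by exact_mod_cast hK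
  have hK0 : (0 : ℝ) < K := by linarith
  have hd0 : (0 : ℝ) < d := by exact_mod_cast hd
  have hδK : 0 < Real.log (K / δ) := Real.log_pos ((one_lt_div hδ).2 (by linarith))
  have hδ2 : 0 < Real.log (1 / δ) := Real.log_pos ((one_lt_div hδ).2 hδ1)
  set M := max (max (detTerm K L R lam) (stochTerm K L R σ α lam β))
        (max (biasTerm L R σ α lam) (dpTerm d K L R lam β ε δ)) with hM
  have hT1 : detTerm K L R lam ≤ M := (le_max_left _ _).trans (le_max_left _ _)
  have hT2 : stochTerm K L R σ α lam β ≤ M := (le_max_right _ _).trans (le_max_left _ _)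
  have hT3 : biasTerm L R σ α lam ≤ M := (le_max_left _ _).trans (le_max_right _ _)
  have hT4 : dpTerm d K L R lam β ε δ ≤ M := (le_max_right _ _).trans (le_max_right _ _)
  rw [detTerm] at hT1
  rw [stochTerm] at hT2
  rw [biasTerm] at hT3
  rw [dpTerm] at hT4
  rw [dpScale] at hup
  rw [stepSizeMin] at hγ
  set l := Real.log (K / β)
  set S := effNoise L R σ α lam
  set B := biasFactor L R σ α lam
  have hM0 : 0 ≤ M := le_trans (by positivity) hT1
  have hfin : ∀ m : ℝ, 0 < m → R ^ 2 / (m * K) ≤ (1 + a₂) * M →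
      2 * R ^ 2 / (c * m * K) ≤ 2 / c * (1 + a₂) * M := by
    intro m hm h
    calc 2 * R ^ 2 / (c * m * K) = 2 / c * (R ^ 2 / (m * K)) := by field_simp
      _ ≤ 2 / c * ((1 + a₂) * M) := by gcongr
      _ = _ := by ring
  have hfin' : ∀ m : ℝ, 0 < m → R ^ 2 / (m * K) ≤ M →
      2 * R ^ 2 / (c * m * K) ≤ 2 / c * (1 + a₂) * M := fun m hm h =>
    hfin m hm (h.trans (by nlinarith))
  rw [hγ]
  -- One case per entry of the minimum. Each gives the first summand of its term; the second is
  -- nonnegative and only enlarges the bound. The factor `a₂` arises only from the privacy entry.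
  rcases min_choice (min (1 / L) (R / (lam ^ (1 - α / 2) * √(K * l * S))))
    (min (R * lam ^ (α - 1) / (K * S * B)) (R / (σω * √(d * K * l)))) with h | h <;> rw [h]
  · rcases min_choice (1 / L) (R / (lam ^ (1 - α / 2) * √(K * l * S))) with h | h <;> rw [h]
    · refine hfin' _ (by positivity) (le_trans ?_ hT1)
      have : R ^ 2 / (1 / L * K) = L * R ^ 2 / K := by field_simp
      rw [this]
      exact le_add_of_nonneg_right (by positivity)
    · refine hfin' _ (by positivity) (le_trans ?_ hT2)
      have e : √(K * l * S) / K = √(S * l / K) := by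
        rw [div_eq_iff hK0.ne', ← Real.sqrt_sq hK0.le, ← Real.sqrt_mul (by positivity),
          Real.sqrt_sq hK0.le]
        congr 1
        field_simp
      have : R ^ 2 / (R / (lam ^ (1 - α / 2) * √(K * l * S)) * K)
          = R * lam ^ (1 - α / 2) * (√(K * l * S) / K) := by field_simp
      rw [this, e]
      exact le_add_of_nonneg_right (by positivity)
  · rcases min_choice (R * lam ^ (α - 1) / (K * S * B)) (R / (σω * √(d * K * l))) with h | h <;>
      rw [h]
    · refine hfin' _ (by positivity) (le_trans ?_ hT3)
      have : R ^ 2 / (R * lam ^ (α - 1) / (K * S * B) * K) = R * S * B / lam ^ (α - 1) := by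
        field_simp
      rw [this]
      exact le_add_of_nonneg_right (by positivity)
    · refine hfin _ (by positivity) ?_
      have e : √(K * Real.log (K / δ) * Real.log (1 / δ)) * (√(d * K * l) / K)
          = √(d * l * Real.log (K / δ) * Real.log (1 / δ)) := by
        rw [← mul_div_assoc, div_eq_iff hK0.ne', ← Real.sqrt_mul (by positivity)]
        nth_rewrite 5 [← Real.sqrt_sq hK0.le]
        rw [← Real.sqrt_mul (by positivity)]
        congr 1
        ring
      calc R ^ 2 / (R / (σω * √(d * K * l)) * K) = R * σω * (√(d * K * l) / K) := by field_simp
        _ ≤ R * (a₂ * (lam / ε * √(K * Real.log (K / δ) * Real.log (1 / δ))))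
            * (√(d * K * l) / K) := by gcongr
        _ = a₂ * (R * lam / ε * (√(K * Real.log (K / δ) * Real.log (1 / δ))
            * (√(d * K * l) / K))) := by ring
        _ ≤ a₂ * M := by
            rw [e]
            gcongr
            exact le_trans (le_add_of_nonneg_right (by positivity)) hT4
        _ ≤ (1 + a₂) * M := by nlinarith

end StepSize

lemma iterate_succ {d : ℕ} {Ξ : Type*} (ℓ : Ξ → Vec d → ℝ) (γ lam : ℝ) (x₀ : Vec d) (ξ : ℕ → Ξ) (w : ℕ → Vec d) (k : ℕ) :
    iterate ℓ γ lam x₀ ξ w (k + 1) = iterate ℓ γ lam x₀ ξ w k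
      - γ • (clip (∇ (ℓ (ξ k)) (iterate ℓ γ lam x₀ ξ w k)) lam + w k) := rfl

/-! ### The good event and the high-probability guarantee -/

section HighProbability

variable {d : ℕ} {Ξ : Type*} [MeasurableSpace Ξ] {D : Measure Ξ} [IsProbabilityMeasure D]
  {ℓ : Ξ → Vec d → ℝ}

/-- The mean of the clipped stochastic gradient. -/
noncomputable def meanClip (D : Measure Ξ) (ℓ : Ξ → Vec d → ℝ) (lam : ℝ) (x : Vec d) : Vec d :=
  ∫ ξ, clip (∇ (ℓ ξ) x) lam ∂D

lemma measurable_meanClip (hℓ : Measurable fun p : Ξ × Vec d => ∇ (ℓ p.1) p.2) (lam : ℝ) :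
    Measurable (meanClip D ℓ lam) := by
  have h : StronglyMeasurable fun p : Vec d × Ξ => clip (∇ (ℓ p.2) p.1) lam :=
    (measurable_clip.comp (hℓ.comp measurable_swap)).stronglyMeasurable
  exact h.integral_prod_right'.measurable

open Classical in
/-- The scaled noise of one step from `x`, set to zero outside of the ball of radius `√2 R`. -/
noncomputable def stoppedNoise (D : Measure Ξ) (ℓ : Ξ → Vec d → ℝ) (xs : Vec d)
    (lam R γ l : ℝ) (z : Vec d × (Ξ × Vec d)) : ℝ :=
  if ‖z.1 - xs‖ ^ 2 ≤ 2 * R ^ 2 then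
    4 * l / R ^ 2 * noiseTerm γ (z.1 - xs)
      (clip (∇ (ℓ z.2.1) z.1) lam - meanClip D ℓ lam z.1) z.2.2
  else 0

lemma measurable_stoppedNoise (hℓ : Measurable fun p : Ξ × Vec d => ∇ (ℓ p.1) p.2)
    (xs : Vec d) (lam R γ l : ℝ) : Measurable (stoppedNoise D ℓ xs lam R γ l) := by
  have h1 : Measurable fun z : Vec d × (Ξ × Vec d) => clip (∇ (ℓ z.2.1) z.1) lam :=
    measurable_clip.comp
      (hℓ.comp (f := fun z : Vec d × (Ξ × Vec d) => (z.2.1, z.1)) (by fun_prop))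
  have h2 : Measurable fun z : Vec d × (Ξ × Vec d) => meanClip D ℓ lam z.1 :=
    (measurable_meanClip hℓ lam).comp measurable_fst
  unfold stoppedNoise noiseTerm
  refine Measurable.ite (measurableSet_le (by fun_prop) (by fun_prop)) ?_ measurable_const
  fun_prop

/-- The guarantee for at least three steps and a ball of positive radius. -/
lemma high_probability_bound (hℓ : Measurable fun p : Ξ × Vec d => ∇ (ℓ p.1) p.2)
    {x₀ xs : Vec d} {A L R σ α : ℝ} (hA : 0 < A) (hL : 0 < L) (hR : 0 < R) (hσ : 0 < σ)
    (hα : 1 < α)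
    (hα2 : α ≤ 2) (hx₀ : ‖x₀ - xs‖ ≤ R)
    (hmin : IsMinOn (objective D ℓ) (Metric.closedBall xs (2 * R)) xs)
    (hs : SmoothOn (objective D ℓ) L (Metric.closedBall xs (2 * R)))
    (hconv : FirstOrderConvexOn (objective D ℓ) (Metric.closedBall xs (2 * R)))
    (hor : HeavyTailedOracle D ℓ σ α (Metric.closedBall xs (2 * R)))
    {K : ℕ} {β lam σω γ c : ℝ} (hd : 1 ≤ d) (hK : 3 ≤ K) (hβ : 0 < β) (hβ1 : β ≤ 1)
    (hlam : 0 < lam) (hσω : 0 < σω)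
    (hlamA : lam ^ α * Real.log (K / β) ≤ A ^ α * K * effNoise L R σ α lam)
    (hc : 0 < c) (hcA : c * max 1 A ≤ 1 / 100)
    (hγ : γ = c * stepSizeMin d K L R σ α lam β σω)
    {Ω : Type*} [MeasurableSpace Ω] {P : Measure Ω} [IsProbabilityMeasure P]
    {ξ : ℕ → Ω → Ξ} {w : ℕ → Ω → Vec d} (hξ : ∀ k, Measurable (ξ k)) (hw : ∀ k, Measurable (w k))
    (hlaw : ∀ k, HasLaw (fun ω => (ξ k ω, w k ω)) (D.prod (gaussianNoise d σω)) P)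
    (hind : iIndepFun (fun k ω => (ξ k ω, w k ω)) P) :
    ENNReal.ofReal (1 - β) ≤
      P {ω | bestValue (objective D ℓ)
          (iterate ℓ γ lam x₀ (fun k => ξ k ω) (fun k => w k ω)) K - objective D ℓ xs
          ≤ 2 * R ^ 2 / (γ * K)} := by
  set f := objective D ℓ with hf
  set l := Real.log (K / β) with hl_def
  set x : ℕ → Ω → Vec d := fun k ω => iterate ℓ γ lam x₀ (fun k => ξ k ω) (fun k => w k ω) k
    with hx
  have hK3 : (3 : ℝ) ≤ K := by exact_mod_cast hK
  have hK0 : (0 : ℝ) < K := by linarith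
  -- `K / β ≥ 3 > e`.
  have hl : 1 ≤ l := by
    rw [hl_def, Real.le_log_iff_exp_le (by positivity), le_div_iff₀ hβ]
    have h1 := Real.exp_one_lt_d9
    have h2 := Real.exp_pos 1
    nlinarith
  have hl0 : 0 < l := by linarith
  have hγ0 : 0 < γ :=
    hγ ▸ mul_pos hc (stepSizeMin_pos hL hR hσ hlam hd (by omega) hl0 hσω)
  obtain ⟨b1, b2, b3, b4, b5⟩ := stepSize_bounds hL hR hσ hα hα2 hlam hd (by omega) hl0 hσω hA hc
    hcA hlamA hγ
  have hS := effNoise_pos (L := L) (R := R) (α := α) (lam := lam) hσ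
  have hB := biasFactor_pos (α := α) hL hR hσ hlam
  have hball : ∀ y : Vec d, ‖y - xs‖ ^ 2 ≤ 2 * R ^ 2 → y ∈ Metric.closedBall xs (2 * R) := by
    intro y hy
    rw [mem_closedBall_iff_norm]
    apply le_of_sq_le_sq _ (by positivity)
    nlinarith
  have hσS : σ ^ α ≤ effNoise L R σ α lam := by
    have := zeta_nonneg (L := L) (R := R) (lam := lam)
    rw [effNoise]
    exact le_add_of_nonneg_right (by positivity)
  have hmeas : ∀ y : Vec d, Measurable fun ξ : Ξ => ∇ (ℓ ξ) y := fun y =>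
    hℓ.comp measurable_prodMk_right
  set 𝔟 := 2 * (effNoise L R σ α lam * biasFactor L R σ α lam / lam ^ (α - 1)) with h𝔟
  have h𝔟0 : 0 ≤ 𝔟 := by positivity
  have hbias : ∀ y : Vec d, ‖y - xs‖ ^ 2 ≤ 2 * R ^ 2 → ‖meanClip D ℓ lam y - ∇ f y‖ ≤ 𝔟 := by
    intro y hy
    have hyb := hball y hy
    obtain ⟨⟨o1, o2⟩, o3, o4⟩ := hor y hyb
    refine (norm_integral_clip_sub_le o1 o2 hlam hα hα2 zeta_nonneg (z := zeta L R lam) ?_ o3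
      o4).trans (zeta_add_le hL hR hσ hlam hα)
    have h1 := norm_gradient_le hR hmin hs hyb
    rw [mem_closedBall_iff_norm] at hyb
    have h2 : L * ‖y - xs‖ ≤ L * (2 * R) := by gcongr
    have h3 : 2 * L * R - lam / 2 ≤ zeta L R lam := le_max_right _ _
    linarith
  -- Outside the ball the stopped noise vanishes and the integral is 1, so the bound holds at every
  -- state, as the Chernoff bound demands.
  have hexp : ∀ y : Vec d, ∫⁻ z, ENNReal.ofReal (Real.exp (stoppedNoise D ℓ xs lam R γ l (y, z)))
      ∂(D.prod (gaussianNoise d σω)) ≤ ENNReal.ofReal (Real.exp (l / K)) := by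
    intro y
    by_cases hy : ‖y - xs‖ ^ 2 ≤ 2 * R ^ 2
    · obtain ⟨⟨o1, o2⟩, o3, o4⟩ := hor y (hball y hy)
      have hint := integrable_clip (lam := lam) o1.1 hlam
      have hm : ‖meanClip D ℓ lam y‖ ≤ lam := by
        have := norm_integral_le_of_norm_le_const (μ := D)
          (.of_forall fun ξ => norm_clip_le hlam (∇ (ℓ ξ) y))
        simpa [meanClip] using this
      simp only [stoppedNoise, if_pos hy]
      refine lintegral_exp_noiseTerm_le (lam := lam)
        (θ := fun ξ => clip (∇ (ℓ ξ) y) lam - meanClip D ℓ lam y)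
        ((measurable_clip.comp (hmeas y)).sub_const _) (fun ξ => ?_) ?_
        ((integral_norm_clip_sub_sq_le o1 hlam hα hα2 o3 o4).trans ?_) (by positivity) hd
        (by omega) hR hγ0.le hlam hl hy b2 b3 b5
      · exact (norm_sub_le _ _).trans (by linarith [norm_clip_le hlam (∇ (ℓ ξ) y)])
      · rw [integral_sub hint (integrable_const _)]
        simp [meanClip]
      · gcongr
    · simp only [stoppedNoise, if_neg hy]
      simpa using Real.one_le_exp (by positivity)
  have hstep : Measurable fun z : Vec d × (Ξ × Vec d) =>
      z.1 - γ • (clip (∇ (ℓ z.2.1) z.1) lam + z.2.2) := by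
    have h1 : Measurable fun z : Vec d × (Ξ × Vec d) => clip (∇ (ℓ z.2.1) z.1) lam :=
      measurable_clip.comp
        (hℓ.comp (f := fun z : Vec d × (Ξ × Vec d) => (z.2.1, z.1)) (by fun_prop))
    fun_prop
  have hbad := measure_exists_sum_ge_le (fun k => (hξ k).prodMk (hw k))
    (fun k => (hlaw k).map_eq) hind hstep (H := x) (t₀ := x₀) (fun _ => rfl) (fun _ _ => rfl)
    (measurable_stoppedNoise (D := D) hℓ xs lam R γ l) (by omega : 1 ≤ K) hl0.le hexp
  have hβe : K * Real.exp (-l) = β := by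
    rw [Real.exp_neg, hl_def, Real.exp_log (by positivity)]
    field_simp
  rw [hβe] at hbad
  set bad := {ω | ∃ k ≤ K, 1 ≤ k ∧
    2 * l ≤ ∑ j ∈ Finset.range k, stoppedNoise D ℓ xs lam R γ l (x j ω, (ξ j ω, w j ω))}
  have hgood : badᶜ ⊆ {ω | bestValue f (fun k => x k ω) K - f xs ≤ 2 * R ^ 2 / (γ * K)} := by
    intro ω hω
    refine bestValue_sub_le f _ (by omega) hγ0 (sum_gap_le hL hR hmin hs hconv hx₀
      (x := fun k => x k ω) (G := fun k => meanClip D ℓ lam (x k ω))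
      (θ := fun k => clip (∇ (ℓ (ξ k ω)) (x k ω)) lam - meanClip D ℓ lam (x k ω))
      (w := fun k => w k ω) (fun k => ?_) hγ0.le (by linarith) (fun k hk => hbias _ hk) ?_ h𝔟0 ?_)
    · simp only [hx, iterate_succ, add_sub_cancel]
    · have e1 : K * (γ * 𝔟) ≤ R / 50 := by rw [h𝔟]; linarith
      have h0 : 0 ≤ γ * 𝔟 := by positivity
      have e2 : γ * 𝔟 ≤ R / 50 := le_trans (le_mul_of_one_le_left h0 (by linarith)) e1
      calc K * (3 * R * (γ * 𝔟) + 4 * (γ * 𝔟) ^ 2)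
          = (K * (γ * 𝔟)) * (3 * R + 4 * (γ * 𝔟)) := by ring
        _ ≤ (R / 50) * (3 * R + 4 * (R / 50)) := by gcongr
        _ ≤ R ^ 2 / 2 := by nlinarith
    · intro k hk hin
      rcases Nat.eq_zero_or_pos k with rfl | hk1
      · simp; positivity
      -- While the earlier iterates lie in the ball, stopped and actual noise agree, so avoiding the
      -- bad event bounds the actual noise.
      have h1 : ∑ j ∈ Finset.range k, stoppedNoise D ℓ xs lam R γ l (x j ω, (ξ j ω, w j ω))
          < 2 * l := by
        by_contra hcon
        exact hω ⟨k, hk, hk1, not_lt.1 hcon⟩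
      have h2 : ∑ j ∈ Finset.range k, stoppedNoise D ℓ xs lam R γ l (x j ω, (ξ j ω, w j ω))
          = 4 * l / R ^ 2 * ∑ j ∈ Finset.range k, noiseTerm γ (x j ω - xs)
            (clip (∇ (ℓ (ξ j ω)) (x j ω)) lam - meanClip D ℓ lam (x j ω)) (w j ω) := by
        rw [Finset.mul_sum]
        refine Finset.sum_congr rfl fun j hj => ?_
        rw [stoppedNoise, if_pos (hin j (Finset.mem_range.1 hj))]
      rw [h2] at h1
      have h3 : 2 * l = 4 * l / R ^ 2 * (R ^ 2 / 2) := by field_simp; norm_num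
      rw [h3] at h1
      exact (lt_of_mul_lt_mul_left h1 (by positivity)).le
  -- Subadditivity suffices, so no measurability of the events is needed.
  rw [ENNReal.ofReal_sub _ hβ.le, ENNReal.ofReal_one, tsub_le_iff_left]
  calc 1 = P Set.univ := measure_univ.symm
    _ ≤ P (bad ∪ badᶜ) := by rw [Set.union_compl_self]
    _ ≤ P bad + P badᶜ := measure_union_le _ _
    _ ≤ _ := add_le_add hbad (measure_mono hgood)

end HighProbability

end DPClippedSGD

/-- Order of quantifiers: `A` is the constant in the admissible range of clipping levels, `c` the
constant in the choice of the step-size, `a₁, a₂` those in `σω = Θ(…)`, `C` the one in the final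
bound; all are chosen before, and so do not depend on, the problem and the other parameters. -/
theorem mainTheorem4 :
    ∀ A : ℝ, 0 < A → ∃ c₀ : ℝ, 0 < c₀ ∧ ∀ c : ℝ, 0 < c → c ≤ c₀ →
    ∀ a₁ a₂ : ℝ, 0 < a₁ → a₁ ≤ a₂ → ∃ C : ℝ, 0 < C ∧
    -- the problem
    ∀ (d : ℕ) (_ : 1 ≤ d)
      (Ξ : Type*) (_ : MeasurableSpace Ξ) (D : Measure Ξ) (_ : IsProbabilityMeasure D)
      (ℓ : Ξ → DPClippedSGD.Vec d → ℝ)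
      (_ : Measurable (Function.uncurry ℓ))
      (_ : Measurable (fun p : Ξ × DPClippedSGD.Vec d => ∇ (ℓ p.1) p.2))
      (_ : ∀ x, Integrable (fun ξ => ℓ ξ x) D)
      (x₀ xstar : DPClippedSGD.Vec d) (L R σ α : ℝ)
      (_ : 0 < L) (_ : 0 < σ) (_ : 1 < α) (_ : α ≤ 2) (_ : ‖x₀ - xstar‖ ≤ R)
      -- the assumptions on the ball of radius `2 R` around the minimizer `xstar`
      (_ : IsMinOn (DPClippedSGD.objective D ℓ) (Metric.closedBall xstar (2 * R)) xstar)
      (_ : DPClippedSGD.SmoothOn (DPClippedSGD.objective D ℓ) L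
        (Metric.closedBall xstar (2 * R)))
      (_ : DPClippedSGD.FirstOrderConvexOn (DPClippedSGD.objective D ℓ)
        (Metric.closedBall xstar (2 * R)))
      (_ : DPClippedSGD.HeavyTailedOracle D ℓ σ α (Metric.closedBall xstar (2 * R)))
      -- the parameters of the method
      (K : ℕ) (β lam ε δ σω γ : ℝ)
      (_ : 1 ≤ K) (_ : 0 < β) (_ : β ≤ 1) (_ : 0 < lam) (_ : 0 < ε) (_ : 0 < δ) (_ : δ < 1)
      (_ : lam ^ α * Real.log (K / β) ≤ A ^ α * K * DPClippedSGD.effNoise L R σ α lam)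
      (_ : a₁ * DPClippedSGD.dpScale K lam ε δ ≤ σω)
      (_ : σω ≤ a₂ * DPClippedSGD.dpScale K lam ε δ)
      (_ : γ = c * DPClippedSGD.stepSizeMin d K L R σ α lam β σω)
      -- the samples and the DP noise
      (Ω : Type*) (_ : MeasurableSpace Ω) (P : Measure Ω) (_ : IsProbabilityMeasure P)
      (ξ : ℕ → Ω → Ξ) (w : ℕ → Ω → DPClippedSGD.Vec d)
      (_ : ∀ k, Measurable (ξ k)) (_ : ∀ k, Measurable (w k))
      (_ : ∀ k, HasLaw (fun ω => (ξ k ω, w k ω))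
        (D.prod (DPClippedSGD.gaussianNoise d σω)) P)
      (_ : iIndepFun (fun k ω => (ξ k ω, w k ω)) P),
      ENNReal.ofReal (1 - β) ≤
        P {ω | DPClippedSGD.bestValue (DPClippedSGD.objective D ℓ)
              (DPClippedSGD.iterate ℓ γ lam x₀ (fun k => ξ k ω) (fun k => w k ω)) K
            - DPClippedSGD.objective D ℓ xstar ≤
          C * max (max (DPClippedSGD.detTerm K L R lam)
                (DPClippedSGD.stochTerm K L R σ α lam β))
              (max (DPClippedSGD.biasTerm L R σ α lam)
                (DPClippedSGD.dpTerm d K L R lam β ε δ))} := by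
  intro A hA
  have hA1 : 0 < max 1 A := lt_max_of_lt_left one_pos
  refine ⟨1 / (100 * max 1 A), by positivity, ?_⟩
  intro c hc hc0 a₁ a₂ ha₁ ha₁₂
  have ha₂ : 0 < a₂ := ha₁.trans_le ha₁₂
  have hcA : c * max 1 A ≤ 1 / 100 := by
    calc c * max 1 A ≤ 1 / (100 * max 1 A) * max 1 A := by gcongr
      _ = 1 / 100 := by field_simp
  -- The summand 2 serves the cases `K ≤ 2` and `R = 0`, the other one the rate `2 R² / (γ K)`.
  refine ⟨2 + 2 / c * (1 + a₂), by positivity, ?_⟩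
  intro d hd Ξ _ D _ ℓ _ hℓ _ x₀ xs L R σ α hL hσ hα hα2 hx₀ hmin hs hconv hor K β lam ε δ σω γ
    hK hβ hβ1 hlam hε hδ hδ1 hlamA hlow hup hγ Ω _ P _ ξ w hξ hw hlaw hind
  have hR0 : 0 ≤ R := (norm_nonneg _).trans hx₀
  have hK1 : (1 : ℝ) ≤ K := by exact_mod_cast hK
  have hdet0 : 0 ≤ DPClippedSGD.detTerm K L R lam := by
    unfold DPClippedSGD.detTerm; positivity
  set M := max (max (DPClippedSGD.detTerm K L R lam) (DPClippedSGD.stochTerm K L R σ α lam β))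
    (max (DPClippedSGD.biasTerm L R σ α lam) (DPClippedSGD.dpTerm d K L R lam β ε δ)) with hM
  have hdet : DPClippedSGD.detTerm K L R lam ≤ M := (le_max_left _ _).trans (le_max_left _ _)
  have hM0 : 0 ≤ M := hdet0.trans hdet
  have hmul : ∀ r : ℝ, r ≤ 2 + 2 / c * (1 + a₂) → r * M ≤ (2 + 2 / c * (1 + a₂)) * M :=
    fun r hr => mul_le_mul_of_nonneg_right hr hM0
  have hcC : 0 ≤ 2 / c * (1 + a₂) := by positivity
  have hfirst := DPClippedSGD.sub_le_of_norm_sub_le hL hR0 hmin hs hconv hx₀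
  -- For `K ≤ 2` the logarithm may be below 1, and for `R = 0` the step-size vanishes. In both cases
  -- the starting point already satisfies the bound.
  by_cases hsmall : K ≤ 2 ∨ R = 0
  · have hLR : L * R ^ 2 ≤ 2 * M := by
      rcases hsmall with h2 | rfl
      · have hK2 : (K : ℝ) ≤ 2 := by exact_mod_cast h2
        have h3 : L * R ^ 2 / K ≤ DPClippedSGD.detTerm K L R lam := by
          unfold DPClippedSGD.detTerm
          exact le_add_of_nonneg_right (by positivity)
        have h4 : L * R ^ 2 / 2 ≤ L * R ^ 2 / K := by gcongr
        linarith
      · simp; linarith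
    have huniv : ∀ ω, ω ∈ {ω | DPClippedSGD.bestValue (DPClippedSGD.objective D ℓ)
        (DPClippedSGD.iterate ℓ γ lam x₀ (fun k => ξ k ω) (fun k => w k ω)) K
          - DPClippedSGD.objective D ℓ xs ≤ (2 + 2 / c * (1 + a₂)) * M} := by
      intro ω
      have hb : DPClippedSGD.bestValue (DPClippedSGD.objective D ℓ)
          (DPClippedSGD.iterate ℓ γ lam x₀ (fun k => ξ k ω) (fun k => w k ω)) K
          ≤ DPClippedSGD.objective D ℓ x₀ :=
        Finset.inf'_le (f := fun t => DPClippedSGD.objective D ℓ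
          (DPClippedSGD.iterate ℓ γ lam x₀ (fun k => ξ k ω) (fun k => w k ω) t))
          (Finset.mem_range.2 (Nat.succ_pos K))
      have := hmul 2 (by linarith)
      simp only [Set.mem_ofPred_eq]
      linarith
    rw [Set.eq_univ_of_forall huniv, measure_univ]
    exact ENNReal.ofReal_le_one.2 (by linarith)
  · obtain ⟨hK2, hRne⟩ := not_or.1 hsmall
    have hR : 0 < R := hR0.lt_of_ne' hRne
    have hδK : 0 < Real.log (K / δ) := Real.log_pos ((one_lt_div hδ).2 (by linarith))
    have hδ2 : 0 < Real.log (1 / δ) := Real.log_pos ((one_lt_div hδ).2 hδ1)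
    have hK3 : (3 : ℝ) ≤ K := by exact_mod_cast (by omega : 3 ≤ K)
    have hl : 0 < Real.log (K / β) := Real.log_pos ((one_lt_div hβ).2 (by linarith))
    -- The lower bound on the noise scale excludes `σω = 0`, for which the last entry of the minimum
    -- would be a division by zero.
    have hσω : 0 < σω := by
      refine lt_of_lt_of_le (mul_pos ha₁ ?_) hlow
      unfold DPClippedSGD.dpScale
      positivity
    refine (DPClippedSGD.high_probability_bound hℓ hA hL hR hσ hα hα2 hx₀ hmin hs hconv hor hd
      (by omega) hβ hβ1 hlam hσω hlamA hc hcA hγ hξ hw hlaw hind).trans (measure_mono ?_)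
    intro ω hω
    refine le_trans hω ((DPClippedSGD.rate_le hL hR hσ hlam hd hK hl hσω hc hε hδ hδ1 ha₂ hup
      hγ).trans (hmul _ (by linarith)))
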